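/- **Theorem.** Let $n\ge 2$, let $B_r$ be the open ball of radius $r$ centred at $0$ in $\mathbb{R}^n$, and write $\mathcal C E=\mathbb{R}^n\setminus E$. For a kernel $K$, an open set $\Omega$ and a measurable set $E\subset\mathbb{R}^n$ put $$L_K(A,B)=\int_A\int_B K(x-\bar x)\,d\bar x\,dx,$$ $$P_{K,\Omega}(E)=L_K(E\cap\Omega,\mathcal C E\cap\Omega)+L_K(E\cap\Omega,\mathcal C E\setminus\Omega)+L_K(E\setminus\Omega,\mathcal C E\cap\Omega)\in[0,\infty].$$ Let $K$ be a real-valued kernel, twice differentiable on $\mathbb{R}^n\setminus\{0\}$, such that $K(z)\ge 0$ and $K(z)=K(-z)$ for $z\neq 0$, $\int_{\mathbb{R}^n}K(z)\min\{1,|z|\}\,dz<\infty$, $K\ge 1$ in $B_2\setminus\{0\}$, and such that, for some measurable function $K^*:\mathbb{R}^n\to\mathbb{R}$, $$\max\Bigl\{|z|\,|\partial_eK(z)|,\ |z|^2\sup_{|y-z|\le|z|/2}|\partial_{ee}K(y)|\Bigr\}\le K^*(z)\qquad\text{for all } z\in\mathbb{R}^n\setminus\{0\},\ e\in S^{n-1}.$$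 Let $E\subset\mathbb{R}^n$ be a measurable set that is stable for the $K$-perimeter in $B_4$, that is, $P_{K,B_4}(E)<\infty$ and for every vector field $X=X(x,t)\in C^2_c(B_4\times(-1,1);\mathbb{R}^n)$ with integral flow $\Psi_t$ ($\Psi_0=\mathrm{id}$, $\partial_t\Psi_t(x)=X(\Psi_t(x),t)$) and every $\varepsilon>0$ there is $t_0\in(0,1]$ such that, with $F_t=\Psi_t(E)$, $$0\le P_{K,B_4}(F_t\cup E)-P_{K,B_4}(E)+\varepsilon t^2\quad\text{and}\quad 0\le P_{K,B_4}(F_t\cap E)-P_{K,B_4}(E)+\varepsilon t^2\qquad\text{for all } t\in(-t_0,t_0).$$ If $P_{K^*,B_4}(E)<\infty$, then $\chi_E\in BV(B_1)$ and $$\mathrm{Per}_{B_1}(E)=|\nabla\chi_E|(B_1)\le\sqrt2\,n\,\sqrt{P_{K^*,B_4}(E)}+|S^{n-1}|.$$ Here $|\nabla u|(\Omega)=\sup\{\int_\Omega u\,\mathrm{div}\,\phi\,dx:\phi\in C^1_c(\Omega;\mathbb{R}^n),\ |\phi|\le1\}$, $BV(\Omega)$ is the set of $u\in L^1(\Omega)$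 with $|\nabla u|(\Omega)<\infty$, and $|S^{n-1}|$ is the $(n-1)$-dimensional surface measure of the unit sphere. -/

import Mathlib

open MeasureTheory

/-- The interaction `L_K(A, B) = ∫_A ∫_B K(x - y) dy dx`, with values in `[0, ∞]`. -/
noncomputable def interaction {n : ℕ} (K : EuclideanSpace ℝ (Fin n) → ℝ)
    (A B : Set (EuclideanSpace ℝ (Fin n))) : ENNReal :=
  ∫⁻ x in A, ∫⁻ y in B, ENNReal.ofReal (K (x - y))

/-- The `K`-perimeter `P_{K,Ω}(E)` of `E` inside `Ω`, with values in `[0, ∞]`. -/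
noncomputable def nonlocalPerimeter {n : ℕ} (K : EuclideanSpace ℝ (Fin n) → ℝ)
    (Ω E : Set (EuclideanSpace ℝ (Fin n))) : ENNReal :=
  interaction K (E ∩ Ω) (Eᶜ ∩ Ω) + interaction K (E ∩ Ω) (Eᶜ \ Ω)
    + interaction K (E \ Ω) (Eᶜ ∩ Ω)

/-- The structural hypotheses on the kernel `K`, with `Kstar` controlling its derivatives.
The value of `K` at the origin, where `K` may be singular, plays no role. -/
structure IsAdmissibleKernel {n : ℕ} (K Kstar : EuclideanSpace ℝ (Fin n) → ℝ) : Prop where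
  nonneg : ∀ z, z ≠ 0 → 0 ≤ K z
  even : ∀ z, K (-z) = K z
  integrable : Integrable (fun z => K z * min 1 ‖z‖) volume
  one_le : ∀ z, z ≠ 0 → ‖z‖ < 2 → 1 ≤ K z
  /-- `K` is twice differentiable away from the origin. -/
  differentiableAt : ∀ z, z ≠ 0 → DifferentiableAt ℝ K z
  differentiableAt_fderiv : ∀ z, z ≠ 0 → DifferentiableAt ℝ (fderiv ℝ K) z
  aemeasurable_star : AEMeasurable Kstar volume
  /-- `|z| |∂ₑ K(z)| ≤ K*(z)` for every unit vector `e`. -/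
  first_deriv_le : ∀ z, z ≠ 0 → ∀ e : EuclideanSpace ℝ (Fin n), ‖e‖ = 1 →
    ‖z‖ * |fderiv ℝ K z e| ≤ Kstar z
  /-- `|z|² sup_{|y - z| ≤ |z| / 2} |∂ₑₑ K(y)| ≤ K*(z)` for every unit vector `e`. -/
  second_deriv_le : ∀ z, z ≠ 0 → ∀ e : EuclideanSpace ℝ (Fin n), ‖e‖ = 1 →
    ∀ y, ‖y - z‖ ≤ ‖z‖ / 2 → ‖z‖ ^ 2 * |fderiv ℝ (fderiv ℝ K) y e e| ≤ Kstar z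

/-- `X = X(x, t)` is a vector field in `C²_c(Ω × (-1, 1); ℝⁿ)`, extended by zero. -/
def IsTestField {n : ℕ} (Ω : Set (EuclideanSpace ℝ (Fin n)))
    (X : EuclideanSpace ℝ (Fin n) × ℝ → EuclideanSpace ℝ (Fin n)) : Prop :=
  ContDiff ℝ 2 X ∧ HasCompactSupport X ∧ tsupport X ⊆ Ω ×ˢ Set.Ioo (-1 : ℝ) 1

/-- `Ψ` is the integral flow of `X`: `Ψ_0 = id` and `∂_t Ψ_t(x) = X(Ψ_t(x), t)` for
`t ∈ (-1, 1)`. For a test field `X` this determines `Ψ_t`, `t ∈ (-1, 1)`. -/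
def IsIntegralFlow {n : ℕ}
    (X : EuclideanSpace ℝ (Fin n) × ℝ → EuclideanSpace ℝ (Fin n))
    (Ψ : ℝ → EuclideanSpace ℝ (Fin n) → EuclideanSpace ℝ (Fin n)) : Prop :=
  ∀ x, Ψ 0 x = x ∧
    ∀ t ∈ Set.Ioo (-1 : ℝ) 1, HasDerivAt (fun s => Ψ s x) (X (Ψ t x, t)) t

/-- `E` is a stable set for `P_{K,Ω}`. The inequalities `0 ≤ P(F) - P(E) + ε t²` are written
without subtraction, since `P(F)` may be infinite. -/
def IsStableSet {n : ℕ} (K : EuclideanSpace ℝ (Fin n) → ℝ)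
    (Ω E : Set (EuclideanSpace ℝ (Fin n))) : Prop :=
  nonlocalPerimeter K Ω E < ⊤ ∧
  ∀ X Ψ, IsTestField Ω X → IsIntegralFlow X Ψ → ∀ ε : ℝ, 0 < ε →
    ∃ t₀ : ℝ, 0 < t₀ ∧ t₀ ≤ 1 ∧ ∀ t : ℝ, |t| < t₀ →
      nonlocalPerimeter K Ω E
          ≤ nonlocalPerimeter K Ω (Ψ t '' E ∪ E) + ENNReal.ofReal (ε * t ^ 2) ∧
      nonlocalPerimeter K Ω E
          ≤ nonlocalPerimeter K Ω (Ψ t '' E ∩ E) + ENNReal.ofReal (ε * t ^ 2)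

/-- The divergence of a vector field on `ℝⁿ`. -/
noncomputable def divergence {n : ℕ}
    (φ : EuclideanSpace ℝ (Fin n) → EuclideanSpace ℝ (Fin n))
    (x : EuclideanSpace ℝ (Fin n)) : ℝ :=
  ∑ i, fderiv ℝ φ x (EuclideanSpace.single i 1) i

/-- The total variation `|∇u|(Ω)`: the supremum of `∫_Ω u div φ` over all
`φ ∈ C¹_c(Ω; ℝⁿ)` with `|φ| ≤ 1`. As `φ = 0` is admissible, negative values of the integral
do not matter. -/
noncomputable def totalVariation {n : ℕ} (u : EuclideanSpace ℝ (Fin n) → ℝ)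
    (Ω : Set (EuclideanSpace ℝ (Fin n))) : ENNReal :=
  ⨆ (φ : EuclideanSpace ℝ (Fin n) → EuclideanSpace ℝ (Fin n))
    (_ : ContDiff ℝ 1 φ ∧ HasCompactSupport φ ∧ tsupport φ ⊆ Ω ∧ ∀ x, ‖φ x‖ ≤ 1),
    ENNReal.ofReal (∫ x in Ω, u x * divergence φ x)

/-- `u ∈ BV(Ω)`. -/
def MemBV {n : ℕ} (u : EuclideanSpace ℝ (Fin n) → ℝ)
    (Ω : Set (EuclideanSpace ℝ (Fin n))) : Prop :=
  IntegrableOn u Ω volume ∧ totalVariation u Ω < ⊤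

/-- The characteristic function of `E`. -/
noncomputable def charFn {n : ℕ} (E : Set (EuclideanSpace ℝ (Fin n))) :
    EuclideanSpace ℝ (Fin n) → ℝ :=
  E.indicator fun _ => 1

/-- The classical perimeter `Per_Ω(E) = |∇χ_E|(Ω)`. -/
noncomputable def classicalPerimeter {n : ℕ} (Ω E : Set (EuclideanSpace ℝ (Fin n))) : ENNReal :=
  totalVariation (charFn E) Ω

/-- The surface measure `|S^{n-1}|` of the unit sphere of `ℝⁿ`. -/
noncomputable def sphereArea (n : ℕ) : ENNReal :=
  (volume : Measure (EuclideanSpace ℝ (Fin n))).toSphere Set.univ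

/-! Translate E slightly in a unit direction v near the unit ball, damping the motion to zero before
the boundary of B_4. With F_t the displaced set, put E \ F_t and F_t \ E for the mass lost and
gained. The nonlocal perimeter is submodular with an explicit surplus: P(F ∪ E) + P(F ∩ E) plus the
interactions between F \ E and E \ F is at most P(E) + P(F)
(`nonlocalPerimeter_union_add_inter_le`). Stability bounds both P(F ∪ E) and P(F ∩ E) below by P(E)
up to ε t², so the interactions are at most P(F_t) - P(E) + O(ε t²). Adding the lower bound for
P(F_{-t}) turns this into a second difference, where the first-order terms cancel.

That second difference is at most t² P_{K*}(E)
(`IsShiftProfile.nonlocalPerimeter_second_difference_le`). Expanding the kernel and the Jacobians to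
second order yields terms controlled by K* and one term, the product of the Jacobian derivatives,
that still carries K. No inequality K ≤ K* is available, so the K-interaction inside the ball is
bounded separately (`IsAdmissibleKernel.interaction_inter_le`): K is small along almost every ray,
hence K(z) is at most a weighted integral of |D²K| along the ray beyond z, and after a change of
variables and an averaging of translations only values of D²K controlled by K* remain. A cutoff of
slope 4/11 makes the total constant at most 1.

Since K ≥ 1 in B_2, the interactions dominate twice the product of the volumes gained and lost in
B_1, so this product is O(t²) (`volume_gained_mul_lost_le`). The variation in direction v is the sum
p + q of the gain and loss rates, and p + q ≤ |p - q| + 2√(pq). The root gives √(2 P_{K*}), while p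
- q is linear in χ_E and becomes the integral of χ_E against the derivative of a cutoff
(`integral_fderiv_mul_localChar_le`). Summing over coordinates gives n √2 √P_{K*} and the ℓ¹ norm of
a flux, which is at most |S^{n-1}| (`radialCutoff.sum_abs_integral_fderiv_le`). -/

section

open Set Filter Topology

/-! ### Taylor's formula from infinity on a half-line, and integration along rays. -/

variable {n : ℕ}

/-- The quantity is the height at 1 of the tangent at q. If it always exceeded ε, the slope (f -
ε)/(q - 1) of the chord from (1, ε) would be nonincreasing. It is negative once f drops below ε, so
f would lie below a decreasing line and become negative. Neither convexity nor a limit at infinity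
is needed. -/
theorem exists_tangent_intercept_le {f f' : ℝ → ℝ}
    (hf : ∀ s, 1 ≤ s → HasDerivAt f (f' s) s) (hnn : ∀ s, 1 ≤ s → 0 ≤ f s)
    (hsmall : ∀ ε, 0 < ε → ∀ R : ℝ, ∃ s, R < s ∧ f s < ε) {ε : ℝ} (hε : 0 < ε) :
    ∃ q, 1 < q ∧ f q - (q - 1) * f' q ≤ ε := by
  by_contra! hcon
  have hanti : AntitoneOn (fun q => (f q - ε) / (q - 1)) (Ici 2) := by
    have hd : ∀ q, 2 ≤ q → HasDerivAt (fun q => (f q - ε) / (q - 1))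
        ((f' q * (q - 1) - (f q - ε) * 1) / (q - 1) ^ 2) q := by
      intro q hq
      exact ((hf q (by linarith)).sub_const ε).div ((hasDerivAt_id q).sub_const 1)
        (by linarith)
    refine antitoneOn_of_deriv_nonpos (convex_Ici 2)
      (fun q hq => (hd q hq).continuousAt.continuousWithinAt) ?_ ?_
    · intro q hq
      rw [interior_Ici] at hq
      exact (hd q (le_of_lt hq)).differentiableAt.differentiableWithinAt
    · intro q hq
      rw [interior_Ici] at hq
      have hq' : 2 < q := hq
      rw [(hd q hq'.le).deriv]
      refine div_nonpos_of_nonpos_of_nonneg ?_ (sq_nonneg _)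
      have := hcon q (by linarith)
      nlinarith
  obtain ⟨s, hs, hsε⟩ := hsmall (ε / 2) (by linarith) 2
  have hs1 : 0 < s - 1 := by linarith
  set c := (ε / 2) / (s - 1) with hc
  have hcpos : 0 < c := by positivity
  set r := max s (1 + 2 * ε / c) with hr
  have hrs : s ≤ r := le_max_left _ _
  have hr2 : 1 + 2 * ε / c ≤ r := le_max_right _ _
  have h1 := hanti (mem_Ici.2 hs.le) (mem_Ici.2 (hs.le.trans hrs)) hrs
  have h2 : (f s - ε) / (s - 1) ≤ -c := by
    rw [hc, ← neg_div]
    exact div_le_div_of_nonneg_right (by linarith) hs1.le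
  have h3 : (f r - ε) / (r - 1) ≤ -c := h1.trans h2
  rw [div_le_iff₀ (by linarith)] at h3
  have h4 := hnn r (by linarith)
  have h5 : 2 * ε ≤ c * (r - 1) := by
    have : 2 * ε / c ≤ r - 1 := by linarith
    rw [div_le_iff₀ hcpos] at this
    linarith
  linarith

/-- Integration by parts gives f(1) as the integral of (s - 1) f'' over [1, q] plus the tangent
intercept at q, which can be made small. When the right side is finite, (s - 1) f'' is integrable,
which is what the fundamental theorem of calculus needs because f'' need not be continuous. -/
theorem ofReal_le_lintegral_second_deriv {f f' f'' : ℝ → ℝ}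
    (hf : ∀ s, 1 ≤ s → HasDerivAt f (f' s) s) (hf' : ∀ s, 1 ≤ s → HasDerivAt f' (f'' s) s)
    (hm : Measurable f'') (hnn : ∀ s, 1 ≤ s → 0 ≤ f s)
    (hsmall : ∀ ε, 0 < ε → ∀ R : ℝ, ∃ s, R < s ∧ f s < ε) :
    ENNReal.ofReal (f 1) ≤ ∫⁻ s in Ioi (1 : ℝ), ENNReal.ofReal ((s - 1) * |f'' s|) := by
  by_cases hI : ∫⁻ s in Ioi (1 : ℝ), ENNReal.ofReal ((s - 1) * |f'' s|) = ⊤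
  · rw [hI]; exact le_top
  have hint : IntegrableOn (fun s => (s - 1) * f'' s) (Ioi 1) := by
    refine ⟨by fun_prop, ?_⟩
    rw [hasFiniteIntegral_iff_norm]
    refine lt_of_le_of_lt (le_of_eq ?_) (lt_top_iff_ne_top.2 hI)
    refine setLIntegral_congr_fun measurableSet_Ioi fun s hs => ?_
    have hs' : (1 : ℝ) < s := hs
    simp only [Real.norm_eq_abs, abs_mul, abs_of_pos (sub_pos.2 hs')]
  have hint' : IntegrableOn (fun s => (s - 1) * |f'' s|) (Ioi 1) := by
    refine IntegrableOn.congr_fun (f := fun s => ‖(s - 1) * f'' s‖) hint.norm (fun s hs => ?_)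
      measurableSet_Ioi
    have hs' : (1 : ℝ) < s := hs
    simp only [Real.norm_eq_abs, abs_mul, abs_of_pos (sub_pos.2 hs')]
  have hnn' : 0 ≤ᵐ[volume.restrict (Ioi 1)] fun s : ℝ => (s - 1) * |f'' s| := by
    filter_upwards [ae_restrict_mem measurableSet_Ioi] with s hs
    exact mul_nonneg (sub_nonneg.2 (le_of_lt hs)) (abs_nonneg _)
  rw [← ofReal_integral_eq_lintegral_ofReal hint' hnn']
  refine ENNReal.ofReal_le_ofReal (le_of_forall_pos_le_add fun ε hε => ?_)
  obtain ⟨q, hq, hqε⟩ := exists_tangent_intercept_le hf hnn hsmall hε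
  have hFTC : ∫ s in (1 : ℝ)..q, (s - 1) * f'' s
      = ((q - 1) * f' q - f q) - ((1 - 1) * f' 1 - f 1) := by
    refine intervalIntegral.integral_eq_sub_of_hasDerivAt
      (f := fun s => (s - 1) * f' s - f s) (fun s hs => ?_) ?_
    · rw [uIcc_of_le hq.le] at hs
      have := (((hasDerivAt_id' s).sub_const 1).fun_mul (hf' s hs.1)).fun_sub (hf s hs.1)
      convert this using 1
      ring
    · rw [intervalIntegrable_iff_integrableOn_Ioc_of_le hq.le]
      exact hint.mono_set Ioc_subset_Ioi_self
  have hle : ∫ s in (1 : ℝ)..q, (s - 1) * f'' s ≤ ∫ s in Ioi (1 : ℝ), (s - 1) * |f'' s| := by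
    rw [intervalIntegral.integral_of_le hq.le]
    calc ∫ s in Ioc 1 q, (s - 1) * f'' s ≤ ∫ s in Ioc 1 q, (s - 1) * |f'' s| := by
          refine setIntegral_mono_on (hint.mono_set Ioc_subset_Ioi_self)
            (hint'.mono_set Ioc_subset_Ioi_self) measurableSet_Ioc fun s hs => ?_
          exact mul_le_mul_of_nonneg_left (le_abs_self _) (sub_nonneg.2 hs.1.le)
      _ ≤ _ := setIntegral_mono_set hint' hnn' (LE.le.eventuallyLE Ioc_subset_Ioi_self)
  linarith

theorem lintegral_dilation {n : ℕ} {s : ℝ} (hs : 0 < s)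
    (f : EuclideanSpace ℝ (Fin n) → ENNReal) :
    ∫⁻ z, f (s • z) = ENNReal.ofReal ((s ^ n)⁻¹) * ∫⁻ z, f z := by
  have h := (Homeomorph.smulOfNeZero s hs.ne').measurableEmbedding.lintegral_map
    (μ := (volume : Measure (EuclideanSpace ℝ (Fin n)))) f
  have h2 : Measure.map (Homeomorph.smulOfNeZero s hs.ne') volume
      = Measure.map (s • ·) (volume : Measure (EuclideanSpace ℝ (Fin n))) := rfl
  rw [h2, Measure.map_addHaar_smul _ hs.ne', lintegral_smul_measure,
    finrank_euclideanSpace_fin, abs_of_pos (by positivity)] at h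
  exact h.symm

theorem lintegral_Ioi_one_inv_pow {m : ℕ} (hm : 1 ≤ m) :
    ∫⁻ s in Ioi (1 : ℝ), ENNReal.ofReal ((s ^ (m + 1))⁻¹) = ENNReal.ofReal ((m : ℝ)⁻¹) := by
  have hm' : (0 : ℝ) < m := by exact_mod_cast hm
  have h1 : ∀ s ∈ Ioi (1 : ℝ), ENNReal.ofReal ((s ^ (m + 1))⁻¹)
      = ENNReal.ofReal (s ^ (-(m + 1 : ℝ))) := by
    intro s hs
    have hs' : (0 : ℝ) < s := lt_trans one_pos hs
    congr 1
    rw [Real.rpow_neg hs'.le]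
    congr 1
    rw [← Real.rpow_natCast]; push_cast; rfl
  rw [setLIntegral_congr_fun measurableSet_Ioi h1, ← ofReal_integral_eq_lintegral_ofReal,
    integral_Ioi_rpow_of_lt (by linarith) one_pos]
  · congr 1
    simp only [Real.one_rpow]
    have : -((m : ℝ) + 1) + 1 = -m := by ring
    rw [this]
    field_simp
  · exact integrableOn_Ioi_rpow_of_lt (by linarith) one_pos
  · filter_upwards [ae_restrict_mem measurableSet_Ioi] with s hs
    exact Real.rpow_nonneg (le_of_lt (lt_trans one_pos hs)) _

/-- By Tonelli and dilation, integrating the ray integrals over z produces the factor s^{-n}, and n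
≥ 2 makes it at most s^{-2}, which is integrable on (1, ∞). -/
theorem ae_lintegral_ray_lt_top {n : ℕ} (hn : 2 ≤ n) {F : EuclideanSpace ℝ (Fin n) → ENNReal}
    (hF : Measurable F) (hfin : ∫⁻ z, F z < ⊤) :
    ∀ᵐ z, ∫⁻ s in Ioi (1 : ℝ), F (s • z) < ⊤ := by
  have hmeas : Measurable fun p : EuclideanSpace ℝ (Fin n) × ℝ => F (p.2 • p.1) :=
    hF.comp (by fun_prop)
  refine ae_lt_top hmeas.lintegral_prod_right' (ne_of_lt ?_)
  rw [lintegral_lintegral_swap hmeas.aemeasurable]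
  calc ∫⁻ s in Ioi (1 : ℝ), ∫⁻ z, F (s • z)
      ≤ ∫⁻ s in Ioi (1 : ℝ), ENNReal.ofReal ((s ^ (1 + 1))⁻¹) * ∫⁻ z, F z := by
        refine setLIntegral_mono' measurableSet_Ioi fun s hs => ?_
        have hs' : (1 : ℝ) < s := hs
        rw [lintegral_dilation (by linarith)]
        gcongr
        · exact hs'.le
    _ = ENNReal.ofReal (((1 : ℕ) : ℝ)⁻¹) * ∫⁻ z, F z := by
        rw [lintegral_mul_const _ (by fun_prop), lintegral_Ioi_one_inv_pow le_rfl]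
    _ < ⊤ := ENNReal.mul_lt_top ENNReal.ofReal_lt_top hfin

theorem hasDerivAt_fderiv_apply_comp {V : Type*} [NormedAddCommGroup V] [NormedSpace ℝ V]
    {f : V → ℝ} {γ : ℝ → V} {v w : V} {s : ℝ} (hf : DifferentiableAt ℝ (fderiv ℝ f) (γ s))
    (hγ : HasDerivAt γ w s) :
    HasDerivAt (fun s => fderiv ℝ f (γ s) v) (fderiv ℝ (fderiv ℝ f) (γ s) w v) s := by
  have h1 : HasDerivAt (fun s => fderiv ℝ f (γ s)) (fderiv ℝ (fderiv ℝ f) (γ s) w) s :=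
    hf.hasFDerivAt.comp_hasDerivAt s hγ
  exact (ContinuousLinearMap.apply ℝ ℝ v).hasFDerivAt.comp_hasDerivAt s h1

/-! ### Decay of the kernel along rays and its radial second derivative. -/

namespace IsAdmissibleKernel

variable {n : ℕ} {K Kstar : EuclideanSpace ℝ (Fin n) → ℝ}

theorem measurable (hK : IsAdmissibleKernel K Kstar) : Measurable K :=
  measurable_of_continuousOn_compl_singleton 0 fun z hz =>
    (hK.differentiableAt z hz).continuousAt.continuousWithinAt

theorem star_nonneg (hK : IsAdmissibleKernel K Kstar) {z : EuclideanSpace ℝ (Fin n)}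
    (hz : z ≠ 0) : 0 ≤ Kstar z := by
  have h := hK.first_deriv_le z hz (‖z‖⁻¹ • z) (norm_smul_inv_norm hz)
  exact le_trans (by positivity) h

/-- The kernel becomes arbitrarily small along almost every ray. -/
theorem ae_small_on_ray (hK : IsAdmissibleKernel K Kstar) (hn : 2 ≤ n) :
    ∀ᵐ z, ∀ ε, 0 < ε → ∀ R : ℝ, ∃ s, R < s ∧ K (s • z) < ε := by
  have hm := hK.measurable
  have hF : Measurable fun z => ENNReal.ofReal (K z * min 1 ‖z‖) := by fun_prop
  have hne : ∀ᵐ z : EuclideanSpace ℝ (Fin n), z ≠ 0 := by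
    have : Nonempty (Fin n) := ⟨⟨0, by omega⟩⟩
    exact Measure.ae_ne volume 0
  filter_upwards [ae_lintegral_ray_lt_top hn hF hK.integrable.lintegral_lt_top, hne]
    with z hz hz0 ε hε R
  by_contra! hcon
  set R' := max (max 1 R) ‖z‖⁻¹ with hR'
  have hzpos : 0 < ‖z‖ := norm_pos_iff.2 hz0
  have : ∫⁻ s in Ioi R', ENNReal.ofReal ε
      ≤ ∫⁻ s in Ioi (1 : ℝ), ENNReal.ofReal (K (s • z) * min 1 ‖s • z‖) := by
    have hsub : Ioi R' ⊆ Ioi (1 : ℝ) :=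
      Ioi_subset_Ioi ((le_max_left _ _).trans (le_max_left _ _))
    refine le_trans (setLIntegral_mono' measurableSet_Ioi fun s hs => ?_)
      (lintegral_mono_set hsub)
    have hs1 : (1 : ℝ) < s := hsub hs
    have hsR : R < s := lt_of_le_of_lt ((le_max_right _ _).trans (le_max_left _ _)) hs
    have hsz : ‖z‖⁻¹ < s := lt_of_le_of_lt (le_max_right _ _) hs
    have h1 : 1 ≤ ‖s • z‖ := by
      rw [norm_smul, Real.norm_eq_abs, abs_of_pos (by linarith)]
      rw [inv_eq_one_div, div_lt_iff₀ hzpos] at hsz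
      exact hsz.le
    rw [min_eq_left h1, mul_one]
    exact ENNReal.ofReal_le_ofReal (hcon s hsR)
  rw [setLIntegral_const, Real.volume_Ioi, ENNReal.mul_top
    (by simpa using hε)] at this
  exact absurd hz (not_lt.2 this)

/-- The second derivative of `K` at `y` in the direction `y` itself, in absolute value. -/
noncomputable def radialSecond (K : EuclideanSpace ℝ (Fin n) → ℝ)
    (y : EuclideanSpace ℝ (Fin n)) : ℝ :=
  |fderiv ℝ (fderiv ℝ K) y y y|

theorem measurable_second (K : EuclideanSpace ℝ (Fin n) → ℝ) :
    Measurable fun p : EuclideanSpace ℝ (Fin n) × EuclideanSpace ℝ (Fin n) =>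
      fderiv ℝ (fderiv ℝ K) p.1 p.2 p.2 := by
  have h1 : Measurable fun p : EuclideanSpace ℝ (Fin n) × EuclideanSpace ℝ (Fin n) =>
      fderiv ℝ (fderiv ℝ K) p.1 := (measurable_fderiv ℝ (fderiv ℝ K)).comp measurable_fst
  have h2 : Measurable fun p : EuclideanSpace ℝ (Fin n) × EuclideanSpace ℝ (Fin n) =>
      fderiv ℝ (fderiv ℝ K) p.1 p.2 :=
    ContinuousLinearMap.measurable_apply₂.comp (h1.prodMk measurable_snd)
  exact ContinuousLinearMap.measurable_apply₂.comp (h2.prodMk measurable_snd)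

theorem measurable_radialSecond (K : EuclideanSpace ℝ (Fin n) → ℝ) :
    Measurable (radialSecond K) :=
  ((measurable_second K).comp (measurable_id.prodMk measurable_id)).abs

/-- Taylor's formula from infinity for s ↦ K(sz). Its second derivative is taken in the direction z;
rewriting it in the direction sz costs the factor s^{-2}. -/
theorem ae_le_lintegral_radialSecond (hK : IsAdmissibleKernel K Kstar) (hn : 2 ≤ n) :
    ∀ᵐ z, ENNReal.ofReal (K z) ≤ ∫⁻ s in Ioi (1 : ℝ),
      ENNReal.ofReal ((s - 1) * (s ^ 2)⁻¹ * radialSecond K (s • z)) := by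
  have hne : ∀ᵐ z : EuclideanSpace ℝ (Fin n), z ≠ 0 := by
    have : Nonempty (Fin n) := ⟨⟨0, by omega⟩⟩
    exact Measure.ae_ne volume 0
  filter_upwards [hK.ae_small_on_ray hn, hne] with z hz hz0
  have hsz : ∀ s : ℝ, 1 ≤ s → s • z ≠ 0 := fun s hs => smul_ne_zero (by linarith) hz0
  have hline : ∀ s : ℝ, HasDerivAt (fun s : ℝ => s • z) z s := fun s => by
    simpa using (hasDerivAt_id s).smul_const z
  have h1 : ∀ s : ℝ, 1 ≤ s → HasDerivAt (fun s : ℝ => K (s • z)) (fderiv ℝ K (s • z) z) s :=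
    fun s hs => (hK.differentiableAt _ (hsz s hs)).hasFDerivAt.comp_hasDerivAt s (hline s)
  have h2 : ∀ s : ℝ, 1 ≤ s → HasDerivAt (fun s : ℝ => fderiv ℝ K (s • z) z)
      (fderiv ℝ (fderiv ℝ K) (s • z) z z) s := fun s hs => by
    exact hasDerivAt_fderiv_apply_comp (hK.differentiableAt_fderiv _ (hsz s hs)) (hline s)
  have hm : Measurable fun s : ℝ => fderiv ℝ (fderiv ℝ K) (s • z) z z := by
    have hp : Measurable fun s : ℝ => (s • z, z) := by fun_prop
    exact (measurable_second K).comp hp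
  have h := ofReal_le_lintegral_second_deriv h1 h2 hm
    (fun s hs => hK.nonneg _ (hsz s hs)) hz
  rw [one_smul] at h
  refine h.trans (le_of_eq (setLIntegral_congr_fun measurableSet_Ioi fun s hs => ?_))
  have hs' : (0 : ℝ) < s := lt_trans one_pos hs
  simp only [radialSecond, map_smul, smul_eq_mul, smul_apply, abs_mul,
    abs_of_pos hs']
  congr 1
  field_simp

/-- The point y/β is at distance (1 - 1/β)|y| ≤ |y|/2 from y exactly because β ≤ 2, so the supremum
defining the second-order bound at y reaches it. -/
theorem radialSecond_inv_smul_le (hK : IsAdmissibleKernel K Kstar)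
    {y : EuclideanSpace ℝ (Fin n)} (hy : y ≠ 0) {β : ℝ} (h1 : 1 ≤ β) (h2 : β ≤ 2) :
    radialSecond K (β⁻¹ • y) ≤ Kstar y := by
  have hb : 0 < β := by linarith
  have hypos : 0 < ‖y‖ := norm_pos_iff.2 hy
  set e := ‖y‖⁻¹ • y with he
  have hye : y = ‖y‖ • e := by rw [he, smul_smul, mul_inv_cancel₀ hypos.ne', one_smul]
  have hdist : ‖β⁻¹ • y - y‖ ≤ ‖y‖ / 2 := by
    have : β⁻¹ • y - y = (β⁻¹ - 1) • y := by rw [sub_smul, one_smul]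
    rw [this, norm_smul, Real.norm_eq_abs, abs_of_nonpos
      (by linarith [inv_le_one_of_one_le₀ h1])]
    have : (2 : ℝ)⁻¹ ≤ β⁻¹ := inv_anti₀ hb h2
    nlinarith
  have h := hK.second_deriv_le y hy e (norm_smul_inv_norm hy) _ hdist
  refine le_trans ?_ h
  have hb1 : β⁻¹ ≤ 1 := inv_le_one_of_one_le₀ h1
  have hb0 : 0 ≤ β⁻¹ := by positivity
  have h3 : radialSecond K (β⁻¹ • y)
      = (β⁻¹ * β⁻¹) * (‖y‖ ^ 2 * |fderiv ℝ (fderiv ℝ K) (β⁻¹ • y) e e|) := by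
    have h4 : fderiv ℝ (fderiv ℝ K) (β⁻¹ • y) y y
        = ‖y‖ ^ 2 * fderiv ℝ (fderiv ℝ K) (β⁻¹ • y) e e := by
      generalize fderiv ℝ (fderiv ℝ K) (β⁻¹ • y) = D
      calc D y y = D (‖y‖ • e) (‖y‖ • e) := by rw [← hye]
        _ = _ := by simp only [map_smul, smul_apply, smul_eq_mul]; ring
    simp only [radialSecond, map_smul, smul_eq_mul, smul_apply, abs_mul,
      abs_of_nonneg hb0, h4, abs_pow, abs_norm]
    ring
  rw [h3]
  exact mul_le_of_le_one_left (by positivity) (mul_le_one₀ hb1 hb0 hb1)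

theorem radialSecond_neg (hK : IsAdmissibleKernel K Kstar) (y : EuclideanSpace ℝ (Fin n)) :
    radialSecond K (-y) = radialSecond K y := by
  have h1 : ∀ x, fderiv ℝ K (-x) = -fderiv ℝ K x := by
    intro x
    have h := fderiv_comp_smul (f := K) (x := x) (-1 : ℝ)
    simp only [neg_smul, one_smul, hK.even] at h
    rw [← neg_eq_iff_eq_neg]
    exact h.symm
  have h2 : fderiv ℝ (fderiv ℝ K) (-y) = fderiv ℝ (fderiv ℝ K) y := by
    have h := fderiv_comp_smul (f := fderiv ℝ K) (x := y) (-1 : ℝ)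
    simp only [neg_smul, one_smul, h1] at h
    rw [fderiv_fun_neg] at h
    exact (neg_injective h).symm
  simp [radialSecond, h2]

end IsAdmissibleKernel

/-! ### Nonlocal perimeters as integrals over pairs of points. -/

open IsAdmissibleKernel

/-- The pairs of points on which the nonlocal perimeter of `E` in `Ω` is an integral. -/
def interfacePairs (Ω E : Set (EuclideanSpace ℝ (Fin n))) :
    Set (EuclideanSpace ℝ (Fin n) × EuclideanSpace ℝ (Fin n)) :=
  {p | p.1 ∈ E ∧ p.2 ∉ E ∧ (p.1 ∈ Ω ∨ p.2 ∈ Ω)}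

theorem measurableSet_interfacePairs {Ω E : Set (EuclideanSpace ℝ (Fin n))}
    (hΩ : MeasurableSet Ω) (hE : MeasurableSet E) : MeasurableSet (interfacePairs Ω E) :=
  (measurable_fst hE).inter ((measurable_snd hE).compl.inter
    ((measurable_fst hΩ).union (measurable_snd hΩ)))

theorem aemeasurable_comp_sub {k : EuclideanSpace ℝ (Fin n) → ENNReal}
    (hk : AEMeasurable k volume) :
    AEMeasurable (fun p : EuclideanSpace ℝ (Fin n) × EuclideanSpace ℝ (Fin n) => k (p.1 - p.2))
      volume :=
  hk.comp_quasiMeasurePreserving (quasiMeasurePreserving_sub volume volume)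

theorem interaction_eq_setLIntegral {K : EuclideanSpace ℝ (Fin n) → ℝ}
    (hK : AEMeasurable K volume) (A B : Set (EuclideanSpace ℝ (Fin n))) :
    interaction K A B = ∫⁻ p in A ×ˢ B, ENNReal.ofReal (K (p.1 - p.2)) := by
  rw [interaction, Measure.volume_eq_prod, setLIntegral_prod]
  rw [← Measure.volume_eq_prod]
  exact (aemeasurable_comp_sub hK.ennreal_ofReal).restrict

theorem nonlocalPerimeter_eq_setLIntegral {K : EuclideanSpace ℝ (Fin n) → ℝ}
    (hK : AEMeasurable K volume) {Ω E : Set (EuclideanSpace ℝ (Fin n))}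
    (hΩ : MeasurableSet Ω) (hE : MeasurableSet E) :
    nonlocalPerimeter K Ω E = ∫⁻ p in interfacePairs Ω E, ENNReal.ofReal (K (p.1 - p.2)) := by
  have hE' := hE.compl
  have h : interfacePairs Ω E
      = ((E ∩ Ω) ×ˢ (Eᶜ ∩ Ω) ∪ (E ∩ Ω) ×ˢ (Eᶜ \ Ω)) ∪ (E \ Ω) ×ˢ (Eᶜ ∩ Ω) := by
    ext ⟨x, y⟩
    simp only [interfacePairs, mem_ofPred_eq, mem_union, mem_prod, mem_inter_iff, Set.mem_sdiff,
      mem_compl_iff]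
    tauto
  rw [h, lintegral_union ((hE.diff hΩ).prod (hE'.inter hΩ)),
    lintegral_union ((hE.inter hΩ).prod (hE'.diff hΩ)), nonlocalPerimeter,
    interaction_eq_setLIntegral hK, interaction_eq_setLIntegral hK,
    interaction_eq_setLIntegral hK]
  · rw [disjoint_left]
    rintro ⟨x, y⟩ h1 h2
    simp only [mem_prod, mem_inter_iff, Set.mem_sdiff] at h1 h2
    tauto
  · rw [disjoint_left]
    rintro ⟨x, y⟩ h1 h2
    simp only [mem_union, mem_prod, mem_inter_iff, Set.mem_sdiff] at h1 h2
    tauto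

/-- Slicing by the difference z = x - y separates the kernel from the geometry: kernels can then be
compared at fixed z and the set enters only through volumes. -/
theorem setLIntegral_comp_sub_eq {k : EuclideanSpace ℝ (Fin n) → ENNReal}
    (hk : AEMeasurable k volume)
    {S : Set (EuclideanSpace ℝ (Fin n) × EuclideanSpace ℝ (Fin n))} (hS : MeasurableSet S) :
    ∫⁻ p in S, k (p.1 - p.2) = ∫⁻ z, k z * volume {y | (y + z, y) ∈ S} := by
  have hmap : Measurable fun p : EuclideanSpace ℝ (Fin n) × EuclideanSpace ℝ (Fin n) =>
      (p.1 + p.2, p.1) := by fun_prop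
  have hsec : ∀ z, MeasurableSet {y : EuclideanSpace ℝ (Fin n) | (y + z, y) ∈ S} := fun z => by
    have : Measurable fun y : EuclideanSpace ℝ (Fin n) => (y + z, y) := by fun_prop
    exact this hS
  rw [← lintegral_indicator hS, Measure.volume_eq_prod, lintegral_prod_symm]
  · have h1 : ∀ y, ∫⁻ x, S.indicator (fun p => k (p.1 - p.2)) (x, y)
        = ∫⁻ z, S.indicator (fun _ => k z) (y + z, y) := by
      intro y
      rw [← lintegral_add_left_eq_self (μ := volume) _ y]
      simp [Set.indicator]
    simp_rw [h1]
    rw [lintegral_lintegral_swap]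
    · refine lintegral_congr fun z => ?_
      have : (fun y => S.indicator (fun _ => k z) (y + z, y))
          = {y | (y + z, y) ∈ S}.indicator fun _ => k z := rfl
      rw [this, lintegral_indicator (hsec z), setLIntegral_const]
    · have h2 : AEMeasurable (fun p : EuclideanSpace ℝ (Fin n) × EuclideanSpace ℝ (Fin n) =>
          ({p | (p.1 + p.2, p.1) ∈ S} :
            Set (EuclideanSpace ℝ (Fin n) × EuclideanSpace ℝ (Fin n))).indicator
            (fun p => k p.2) p) (volume.prod volume) :=
        (hk.comp_snd).indicator (hmap hS)
      exact h2
  · rw [← Measure.volume_eq_prod]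
    exact (aemeasurable_comp_sub hk).indicator hS

/-! ### Jumps of E under translations, and the bound for the K-interaction. -/

/-- The points of `B` at which a translation by `z` stays in `B` and changes membership in `E`. -/
def jumpBoth (B E : Set (EuclideanSpace ℝ (Fin n))) (z : EuclideanSpace ℝ (Fin n)) :
    Set (EuclideanSpace ℝ (Fin n)) :=
  {x | (x ∈ B ∧ x + z ∈ B) ∧ ¬(x ∈ E ↔ x + z ∈ E)}

/-- The points at which a translation by `z` starts or ends in `B` and changes membership
in `E`. -/
def jumpSome (B E : Set (EuclideanSpace ℝ (Fin n))) (z : EuclideanSpace ℝ (Fin n)) :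
    Set (EuclideanSpace ℝ (Fin n)) :=
  {x | (x ∈ B ∨ x + z ∈ B) ∧ ¬(x ∈ E ↔ x + z ∈ E)}

theorem measurable_volume_jumpBoth {B E : Set (EuclideanSpace ℝ (Fin n))}
    (hB : MeasurableSet B) (hE : MeasurableSet E) :
    Measurable fun z => volume (jumpBoth B E z) := by
  refine measurable_measure_prodMk_left (s := {p : EuclideanSpace ℝ (Fin n) ×
    EuclideanSpace ℝ (Fin n) | (p.2 ∈ B ∧ p.2 + p.1 ∈ B) ∧ ¬(p.2 ∈ E ↔ p.2 + p.1 ∈ E)}) ?_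
  have h : Measurable fun p : EuclideanSpace ℝ (Fin n) × EuclideanSpace ℝ (Fin n) =>
    p.2 + p.1 := by fun_prop
  exact ((measurable_snd hB).inter (h hB)).inter
    (MeasurableSet.iff (measurable_snd hE) (h hE)).compl

theorem measurable_volume_jumpSome {B E : Set (EuclideanSpace ℝ (Fin n))}
    (hB : MeasurableSet B) (hE : MeasurableSet E) :
    Measurable fun z => volume (jumpSome B E z) := by
  refine measurable_measure_prodMk_left (s := {p : EuclideanSpace ℝ (Fin n) ×
    EuclideanSpace ℝ (Fin n) | (p.2 ∈ B ∨ p.2 + p.1 ∈ B) ∧ ¬(p.2 ∈ E ↔ p.2 + p.1 ∈ E)}) ?_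
  have h : Measurable fun p : EuclideanSpace ℝ (Fin n) × EuclideanSpace ℝ (Fin n) =>
    p.2 + p.1 := by fun_prop
  exact ((measurable_snd hB).union (h hB)).inter
    (MeasurableSet.iff (measurable_snd hE) (h hE)).compl

/-- A triangle inequality through the third point x - b: if x and x + p lie on different sides of E,
then x - b differs from one of them. That third point may leave B, which is why the right side asks
for only one endpoint in B. -/
theorem volume_jumpBoth_le (B E : Set (EuclideanSpace ℝ (Fin n)))
    (p b : EuclideanSpace ℝ (Fin n)) :
    volume (jumpBoth B E p) ≤ volume (jumpSome B E b) + volume (jumpSome B E (b + p)) := by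
  have hsub : jumpBoth B E p ⊆ (fun x => x + -b) ⁻¹' jumpSome B E b ∪
      (fun x => x + -b) ⁻¹' jumpSome B E (b + p) := by
    intro x hx
    have h1 : x + -b + b = x := by abel
    have h2 : x + -b + (b + p) = x + p := by abel
    simp only [jumpBoth, jumpSome, mem_ofPred_eq, mem_union, mem_preimage, h1, h2] at hx ⊢
    tauto
  refine (measure_mono hsub).trans ((measure_union_le _ _).trans ?_)
  rw [measure_preimage_add_right, measure_preimage_add_right]

/-- Average the triangle inequality with b = βy over β in [1, 2 - τ], an interval of length 1 - τ on
which both β and β + τ stay in [1, 2]. Short translations, where K* gives no control of K, are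
thereby traded for translations comparable to y. -/
theorem volume_jumpBoth_smul_mul_le {B E : Set (EuclideanSpace ℝ (Fin n))}
    (hB : MeasurableSet B) (hE : MeasurableSet E) (y : EuclideanSpace ℝ (Fin n)) {τ : ℝ}
    (h0 : 0 ≤ τ) :
    volume (jumpBoth B E (τ • y)) * ENNReal.ofReal (1 - τ)
      ≤ 2 * ∫⁻ β in Icc (1 : ℝ) 2, volume (jumpSome B E (β • y)) := by
  have hJ : Measurable fun β : ℝ => volume (jumpSome B E (β • y)) :=
    (measurable_volume_jumpSome hB hE).comp (f := fun β : ℝ => β • y) (by fun_prop)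
  have h1 : volume (jumpBoth B E (τ • y)) * ENNReal.ofReal (1 - τ)
      = ∫⁻ β in Icc (1 : ℝ) (2 - τ), volume (jumpBoth B E (τ • y)) := by
    rw [setLIntegral_const, Real.volume_Icc]
    congr 2; ring
  rw [h1, two_mul]
  calc ∫⁻ β in Icc (1 : ℝ) (2 - τ), volume (jumpBoth B E (τ • y))
      ≤ ∫⁻ β in Icc (1 : ℝ) (2 - τ), (volume (jumpSome B E (β • y))
          + volume (jumpSome B E ((β + τ) • y))) := by
        refine lintegral_mono fun β => ?_
        rw [add_smul]
        exact volume_jumpBoth_le B E _ _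
    _ = (∫⁻ β in Icc (1 : ℝ) (2 - τ), volume (jumpSome B E (β • y)))
          + ∫⁻ β in Icc (1 : ℝ) (2 - τ), volume (jumpSome B E ((β + τ) • y)) :=
        lintegral_add_left hJ _
    _ ≤ _ := by
        refine add_le_add (lintegral_mono_set (Icc_subset_Icc_right (by linarith))) ?_
        rw [← lintegral_indicator measurableSet_Icc, ← lintegral_indicator measurableSet_Icc,
          ← lintegral_add_right_eq_self (μ := volume)
            ((Icc (1 : ℝ) 2).indicator fun β => volume (jumpSome B E (β • y))) τ]
        refine lintegral_mono fun β => ?_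
        by_cases hβ : β ∈ Icc (1 : ℝ) (2 - τ)
        · rw [indicator_of_mem hβ, indicator_of_mem]
          exact ⟨by linarith [hβ.1], by linarith [hβ.2]⟩
        · rw [indicator_of_notMem hβ]
          exact zero_le

theorem volume_jumpSome_le {B E : Set (EuclideanSpace ℝ (Fin n))}
    (z : EuclideanSpace ℝ (Fin n)) :
    volume (jumpSome B E z) ≤ volume {y | (y + z, y) ∈ interfacePairs B E}
      + volume {y | (y + -z, y) ∈ interfacePairs B E} := by
  have hsub : jumpSome B E z ⊆ {y | (y + z, y) ∈ interfacePairs B E} ∪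
      (fun x => x + z) ⁻¹' {y | (y + -z, y) ∈ interfacePairs B E} := by
    intro x hx
    have h1 : x + z + -z = x := by abel
    simp only [jumpSome, interfacePairs, mem_ofPred_eq, mem_union, mem_preimage, h1] at hx ⊢
    tauto
  refine (measure_mono hsub).trans ((measure_union_le _ _).trans ?_)
  rw [measure_preimage_add_right]

theorem add_volume_le_volume_jumpBoth {B E : Set (EuclideanSpace ℝ (Fin n))}
    (hB : MeasurableSet B) (hE : MeasurableSet E) (z : EuclideanSpace ℝ (Fin n)) :
    volume {y | (y + z, y) ∈ (E ∩ B) ×ˢ (Eᶜ ∩ B)}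
      + volume {y | (y + -z, y) ∈ (E ∩ B) ×ˢ (Eᶜ ∩ B)} ≤ volume (jumpBoth B E z) := by
  have hS : MeasurableSet ((E ∩ B) ×ˢ (Eᶜ ∩ B)) := (hE.inter hB).prod (hE.compl.inter hB)
  rw [← measure_preimage_add_right volume z {y | (y + -z, y) ∈ (E ∩ B) ×ˢ (Eᶜ ∩ B)},
    ← measure_union]
  · refine measure_mono fun x hx => ?_
    have h1 : x + z + -z = x := by abel
    simp only [jumpBoth, mem_ofPred_eq, mem_union, mem_preimage, h1, mem_prod, mem_inter_iff,
      mem_compl_iff] at hx ⊢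
    tauto
  · rw [disjoint_left]
    intro x h1 h2
    have h3 : x + z + -z = x := by abel
    simp only [mem_ofPred_eq, mem_preimage, h3, mem_prod, mem_inter_iff, mem_compl_iff] at h1 h2
    tauto
  · have h : Measurable fun x : EuclideanSpace ℝ (Fin n) => (x + z + -z, x + z) := by fun_prop
    exact h hS

/-- Away from the boundary of `B`, the `K`-interaction of `E` with its complement is controlled
by the `K*`-perimeter, although `K ≤ K*` is not assumed. -/
theorem IsAdmissibleKernel.interaction_inter_le {K Kstar : EuclideanSpace ℝ (Fin n) → ℝ}
    (hK : IsAdmissibleKernel K Kstar) (hn : 2 ≤ n) {B E : Set (EuclideanSpace ℝ (Fin n))}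
    (hB : MeasurableSet B) (hE : MeasurableSet E) :
    interaction K (E ∩ B) (Eᶜ ∩ B) ≤ nonlocalPerimeter Kstar B E := by
  have hKm := hK.measurable
  set k : EuclideanSpace ℝ (Fin n) → ENNReal := fun z => ENNReal.ofReal (K z) with hk
  set N : EuclideanSpace ℝ (Fin n) → ENNReal := fun z => ENNReal.ofReal (radialSecond K z) with hN
  have hNm : Measurable N := (measurable_radialSecond K).ennreal_ofReal
  set h : EuclideanSpace ℝ (Fin n) → ENNReal := fun z =>
    volume {y | (y + z, y) ∈ (E ∩ B) ×ˢ (Eᶜ ∩ B)} with hh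
  set H : EuclideanSpace ℝ (Fin n) → ENNReal := fun z =>
    volume {y | (y + z, y) ∈ interfacePairs B E} with hH
  set g := fun z => volume (jumpBoth B E z) with hg
  set J := fun z => volume (jumpSome B E z) with hJ
  have hgm : Measurable g := measurable_volume_jumpBoth hB hE
  have hJm : Measurable J := measurable_volume_jumpSome hB hE
  have hsecm : ∀ S : Set (EuclideanSpace ℝ (Fin n) × EuclideanSpace ℝ (Fin n)),
      MeasurableSet S → Measurable fun z => volume {y | (y + z, y) ∈ S} := by
    intro S hS
    have h : Measurable fun p : EuclideanSpace ℝ (Fin n) × EuclideanSpace ℝ (Fin n) =>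
      (p.2 + p.1, p.2) := by fun_prop
    exact measurable_measure_prodMk_left (h hS)
  have hhm : Measurable h := hsecm _ ((hE.inter hB).prod (hE.compl.inter hB))
  have hHm : Measurable H := hsecm _ (measurableSet_interfacePairs hB hE)
  have hne : ∀ᵐ z : EuclideanSpace ℝ (Fin n), z ≠ 0 := by
    have : Nonempty (Fin n) := ⟨⟨0, by omega⟩⟩
    exact Measure.ae_ne volume 0
  set P := nonlocalPerimeter Kstar B E with hP
  have hPeq : P = ∫⁻ z, ENNReal.ofReal (Kstar z) * H z := by
    rw [hP, nonlocalPerimeter_eq_setLIntegral hK.aemeasurable_star hB hE]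
    exact setLIntegral_comp_sub_eq hK.aemeasurable_star.ennreal_ofReal
      (measurableSet_interfacePairs hB hE)
  have hIeq : interaction K (E ∩ B) (Eᶜ ∩ B) = ∫⁻ z, k z * h z := by
    rw [interaction_eq_setLIntegral hKm.aemeasurable]
    exact setLIntegral_comp_sub_eq hKm.aemeasurable.ennreal_ofReal
      ((hE.inter hB).prod (hE.compl.inter hB))
  have hIneg : ∫⁻ z, k z * h z = ∫⁻ z, k z * h (-z) := by
    rw [← lintegral_neg_eq_self]
    simp [hk, hK.even]
  -- Evenness of K symmetrizes the interaction, since a jump may go out of E or into it.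
  have hstep1 : 2 * interaction K (E ∩ B) (Eᶜ ∩ B) ≤ ∫⁻ z, k z * g z := by
    rw [two_mul, hIeq]
    nth_rewrite 2 [hIneg]
    rw [← lintegral_add_left (by fun_prop)]
    refine lintegral_mono fun z => ?_
    rw [← mul_add]
    exact mul_le_mul_right (add_volume_le_volume_jumpBoth hB hE z) _
  have hinner : ∀ β ∈ Icc (1 : ℝ) 2, ∫⁻ y, N (β⁻¹ • y) * J y ≤ 2 * P := by
    intro β hβ
    have hle : ∀ᵐ y, N (β⁻¹ • y) ≤ ENNReal.ofReal (Kstar y) := by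
      filter_upwards [hne] with y hy
      exact ENNReal.ofReal_le_ofReal (hK.radialSecond_inv_smul_le hy hβ.1 hβ.2)
    have hpart : ∫⁻ y, N (β⁻¹ • y) * H y ≤ P := by
      rw [hPeq]
      refine lintegral_mono_ae ?_
      filter_upwards [hle] with y hy
      gcongr
    -- The reflection falls on D²K, which is even because K is; no symmetry of K* is required.
    have hpart' : ∫⁻ y, N (β⁻¹ • y) * H (-y) ≤ P := by
      rw [← lintegral_neg_eq_self]
      simp only [neg_neg, smul_neg]
      simpa only [hN, hK.radialSecond_neg] using hpart
    have hNβ : Measurable fun y => N (β⁻¹ • y) := hNm.comp (by fun_prop)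
    calc ∫⁻ y, N (β⁻¹ • y) * J y ≤ ∫⁻ y, (N (β⁻¹ • y) * H y + N (β⁻¹ • y) * H (-y)) := by
          refine lintegral_mono fun y => ?_
          rw [← mul_add]
          exact mul_le_mul_right (volume_jumpSome_le y) _
      _ = (∫⁻ y, N (β⁻¹ • y) * H y) + ∫⁻ y, N (β⁻¹ • y) * H (-y) :=
          lintegral_add_left (f := fun y => N (β⁻¹ • y) * H y) (hNβ.mul hHm) _
      _ ≤ 2 * P := by rw [two_mul]; exact add_le_add hpart hpart'
  have hmid : ∫⁻ y, N y * ∫⁻ β in Icc (1 : ℝ) 2, J (β • y) ≤ 2 * P := by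
    have hm : Measurable fun p : EuclideanSpace ℝ (Fin n) × ℝ => N p.1 * J (p.2 • p.1) :=
      (hNm.comp measurable_fst).mul (hJm.comp (by fun_prop))
    have hJβ : ∀ y, Measurable fun β : ℝ => J (β • y) := fun y => hJm.comp (by fun_prop)
    simp_rw [← lintegral_const_mul _ (hJβ _)]
    rw [lintegral_lintegral_swap hm.aemeasurable]
    calc ∫⁻ β in Icc (1 : ℝ) 2, ∫⁻ y, N y * J (β • y) ≤ ∫⁻ β in Icc (1 : ℝ) 2, 2 * P := by
          refine setLIntegral_mono' measurableSet_Icc fun β hβ => ?_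
          have hβ0 : (0 : ℝ) < β := lt_of_lt_of_le one_pos hβ.1
          have h1 : ∀ y, N y * J (β • y)
              = (fun y => N (β⁻¹ • y) * J y) (β • y) := fun y => by
            simp only [smul_smul, inv_mul_cancel₀ hβ0.ne', one_smul]
          rw [lintegral_congr h1, lintegral_dilation hβ0 (fun y => N (β⁻¹ • y) * J y)]
          refine le_trans (mul_le_of_le_one_left zero_le ?_) (hinner β hβ)
          rw [ENNReal.ofReal_le_one]
          exact inv_le_one_of_one_le₀ (one_le_pow₀ hβ.1)
      _ = 2 * P := by
          rw [setLIntegral_const, Real.volume_Icc]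
          norm_num
  have hstep2 : ∫⁻ z, k z * g z ≤ 2 * P := by
    have hm0 : Measurable fun p : EuclideanSpace ℝ (Fin n) × ℝ =>
        ENNReal.ofReal ((p.2 - 1) * (p.2 ^ 2)⁻¹ * radialSecond K (p.2 • p.1)) := by
      have : Measurable fun p : EuclideanSpace ℝ (Fin n) × ℝ => radialSecond K (p.2 • p.1) :=
        (measurable_radialSecond K).comp (by fun_prop)
      fun_prop
    calc ∫⁻ z, k z * g z
        ≤ ∫⁻ z, (∫⁻ s in Ioi (1 : ℝ),
            ENNReal.ofReal ((s - 1) * (s ^ 2)⁻¹ * radialSecond K (s • z))) * g z := by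
          refine lintegral_mono_ae ?_
          filter_upwards [hK.ae_le_lintegral_radialSecond hn] with z hz
          gcongr
      _ = ∫⁻ z, ∫⁻ s in Ioi (1 : ℝ),
            ENNReal.ofReal ((s - 1) * (s ^ 2)⁻¹ * radialSecond K (s • z)) * g z := by
          refine lintegral_congr fun z => (lintegral_mul_const _ ?_).symm
          exact hm0.comp (f := fun s : ℝ => (z, s)) (by fun_prop)
      _ = ∫⁻ s in Ioi (1 : ℝ), ∫⁻ z,
            ENNReal.ofReal ((s - 1) * (s ^ 2)⁻¹ * radialSecond K (s • z)) * g z :=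
          lintegral_lintegral_swap (hm0.mul (hgm.comp measurable_fst)).aemeasurable
      _ ≤ ∫⁻ s in Ioi (1 : ℝ), ENNReal.ofReal ((s ^ (2 + 1))⁻¹) * (2 * (2 * P)) := by
          refine setLIntegral_mono' measurableSet_Ioi fun s hs => ?_
          have hs1 : (1 : ℝ) < s := hs
          have hs0 : (0 : ℝ) < s := lt_trans one_pos hs1
          have h1 : ∀ z, ENNReal.ofReal ((s - 1) * (s ^ 2)⁻¹ * radialSecond K (s • z)) * g z
              = (fun y => ENNReal.ofReal (s⁻¹) *
                (N y * (g (s⁻¹ • y) * ENNReal.ofReal (1 - s⁻¹)))) (s • z) := fun z => by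
            -- The Taylor weight contains exactly the factor 1 - τ, with τ = 1/s, that the averaging
            -- inequality needs.
            have h2 : (s - 1) * (s ^ 2)⁻¹ = s⁻¹ * (1 - s⁻¹) := by field_simp
            have h3 : 0 ≤ 1 - s⁻¹ := by
              linarith [inv_le_one_of_one_le₀ hs1.le]
            simp only [smul_smul, inv_mul_cancel₀ hs0.ne', one_smul, h2]
            rw [ENNReal.ofReal_mul (by positivity), ENNReal.ofReal_mul (by positivity)]
            ring
          rw [lintegral_congr h1, lintegral_dilation hs0 (fun y => ENNReal.ofReal (s⁻¹) *
                (N y * (g (s⁻¹ • y) * ENNReal.ofReal (1 - s⁻¹)))), lintegral_const_mul' _ _ ENNReal.ofReal_ne_top,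
            ← mul_assoc, ← ENNReal.ofReal_mul (by positivity)]
          refine mul_le_mul' (ENNReal.ofReal_le_ofReal ?_) ?_
          -- The dilation contributes s^{-n} and the Taylor weight s^{-1}; n ≥ 2 gives s^{-3}.
          · rw [pow_succ, mul_inv]
            gcongr
            exact hs1.le
          · calc ∫⁻ y, N y * (g (s⁻¹ • y) * ENNReal.ofReal (1 - s⁻¹))
                ≤ ∫⁻ y, 2 * (N y * ∫⁻ β in Icc (1 : ℝ) 2, J (β • y)) := by
                  refine lintegral_mono fun y => ?_
                  rw [mul_left_comm 2]
                  exact mul_le_mul_right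
                    (volume_jumpBoth_smul_mul_le hB hE y (inv_nonneg.2 hs0.le)) _
              _ = 2 * ∫⁻ y, N y * ∫⁻ β in Icc (1 : ℝ) 2, J (β • y) :=
                  lintegral_const_mul' _ _ (by simp)
              _ ≤ _ := by gcongr
      _ = 2 * P := by
          rw [lintegral_mul_const _ (by fun_prop), lintegral_Ioi_one_inv_pow (by norm_num)]
          -- The integral of s^{-3} over (1, ∞) is 1/2, which cancels the factor 2 of the averaging.
          have h2 : ENNReal.ofReal (((2 : ℕ) : ℝ)⁻¹) * 2 = 1 := by
            rw [← ENNReal.ofReal_ofNat 2, ← ENNReal.ofReal_mul (by positivity)]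
            norm_num
          rw [← mul_assoc, h2, one_mul]
  have h2 := hstep1.trans hstep2
  exact (ENNReal.mul_le_mul_iff_right (by simp) (by simp)).1 h2

/-! ### Perturbations of the identity, submodularity and change of variables. -/

theorem exists_homeomorph_of_lipschitz_sub_id {V : Type*} [NormedAddCommGroup V]
    [NormedSpace ℝ V] [CompleteSpace V] {f : V → V} {c : NNReal} (hc : c < 1)
    (hf : LipschitzWith c fun x => f x - x) : ∃ h : V ≃ₜ V, ⇑h = f := by
  have happ : ApproximatesLinearOn f (ContinuousLinearEquiv.refl ℝ V : V →L[ℝ] V) univ c := by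
    intro x _ y _
    have := hf.norm_sub_le x y
    refine le_trans (le_of_eq ?_) this
    congr 1
    simp only [ContinuousLinearEquiv.coe_refl, ContinuousLinearMap.coe_id', id]
    abel
  have hc' : Subsingleton V ∨
      c < ‖((ContinuousLinearEquiv.refl ℝ V).symm : V →L[ℝ] V)‖₊⁻¹ := by
    rcases subsingleton_or_nontrivial V with h | h
    · exact Or.inl h
    · right
      have : ‖((ContinuousLinearEquiv.refl ℝ V).symm : V →L[ℝ] V)‖₊ = 1 := by
        ext
        exact ContinuousLinearMap.norm_id
      rw [this, inv_one]
      exact hc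
  exact ⟨happ.toHomeomorph f hc', rfl⟩

/-- This holds pointwise for the indicators of pairs. A pair joining F \ E and E \ F is counted for
E or F but never for the union or the intersection, and this is the surplus. Since E and F differ
only inside Ω, these pairs are all seen by the perimeter in Ω. -/
theorem nonlocalPerimeter_union_add_inter_le {K : EuclideanSpace ℝ (Fin n) → ℝ}
    (hK : Measurable K) {Ω E F : Set (EuclideanSpace ℝ (Fin n))}
    (hΩ : MeasurableSet Ω) (hE : MeasurableSet E) (hF : MeasurableSet F)
    (h1 : E \ F ⊆ Ω) (h2 : F \ E ⊆ Ω) :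
    nonlocalPerimeter K Ω (F ∪ E) + nonlocalPerimeter K Ω (F ∩ E)
        + (interaction K (F \ E) (E \ F) + interaction K (E \ F) (F \ E))
      ≤ nonlocalPerimeter K Ω E + nonlocalPerimeter K Ω F := by
  have hk : Measurable fun p : EuclideanSpace ℝ (Fin n) × EuclideanSpace ℝ (Fin n) =>
      ENNReal.ofReal (K (p.1 - p.2)) := (hK.comp (by fun_prop)).ennreal_ofReal
  have hSE := measurableSet_interfacePairs hΩ hE
  have hSF := measurableSet_interfacePairs hΩ hF
  have hSU := measurableSet_interfacePairs hΩ (hF.union hE)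
  have hSI := measurableSet_interfacePairs hΩ (hF.inter hE)
  have hA := (hF.diff hE).prod (hE.diff hF)
  have hB := (hE.diff hF).prod (hF.diff hE)
  simp only [nonlocalPerimeter_eq_setLIntegral hK.aemeasurable hΩ, hE, hF, hF.union hE,
    hF.inter hE, interaction_eq_setLIntegral hK.aemeasurable]
  rw [← lintegral_indicator hSE, ← lintegral_indicator hSF, ← lintegral_indicator hSU,
    ← lintegral_indicator hSI, ← lintegral_indicator hA, ← lintegral_indicator hB,
    ← lintegral_add_left (hk.indicator hSE), ← lintegral_add_left (hk.indicator hSU),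
    ← lintegral_add_left (hk.indicator hA),
    ← lintegral_add_left ((hk.indicator hSU).fun_add (hk.indicator hSI))]
  refine lintegral_mono fun p => ?_
  obtain ⟨x, y⟩ := p
  have hx1 := @h1 x
  have hx2 := @h2 x
  have hy1 := @h1 y
  have hy2 := @h2 y
  simp only [Set.mem_sdiff] at hx1 hx2 hy1 hy2
  clear h1 h2 hSE hSF hSU hSI hA hB
  simp only [Set.indicator, interfacePairs, mem_ofPred_eq, mem_union, mem_inter_iff, mem_prod,
    Set.mem_sdiff]
  by_cases ha : x ∈ E <;> by_cases hb : x ∈ F <;> by_cases hc : y ∈ E <;> by_cases hd : y ∈ F <;>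
    by_cases he : x ∈ Ω ∨ y ∈ Ω <;> simp_all

/-- Because Ψ preserves Ω as well as its complement, the pairs counted for the image pull back
exactly to those counted for E, with one Jacobian per variable. -/
theorem nonlocalPerimeter_image {K : EuclideanSpace ℝ (Fin n) → ℝ}
    (hK : Measurable K) {Ω E : Set (EuclideanSpace ℝ (Fin n))}
    (hΩ : MeasurableSet Ω) (hE : MeasurableSet E)
    {Ψ : EuclideanSpace ℝ (Fin n) → EuclideanSpace ℝ (Fin n)}
    {Ψ' : EuclideanSpace ℝ (Fin n) → EuclideanSpace ℝ (Fin n) →L[ℝ] EuclideanSpace ℝ (Fin n)}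
    (hbij : Function.Bijective Ψ) (hd : ∀ x, HasFDerivAt Ψ (Ψ' x) x)
    (hmem : ∀ x, Ψ x ∈ Ω ↔ x ∈ Ω) {J : EuclideanSpace ℝ (Fin n) → ℝ} (hJ : Measurable J)
    (hJ0 : ∀ x, 0 ≤ J x) (hdet : ∀ x, (Ψ' x).det = J x) :
    nonlocalPerimeter K Ω (Ψ '' E)
      = ∫⁻ p in interfacePairs Ω E, ENNReal.ofReal (K (Ψ p.1 - Ψ p.2) * (J p.1 * J p.2)) := by
  have hΨm : Measurable Ψ :=
    (continuous_iff_continuousAt.2 fun x => (hd x).continuousAt).measurable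
  have hEm : MeasurableSet (Ψ '' E) :=
    measurable_image_of_fderivWithin hE (fun x _ => (hd x).hasFDerivWithinAt)
      hbij.injective.injOn
  have hcv : ∀ f : EuclideanSpace ℝ (Fin n) → ENNReal,
      ∫⁻ x, f x = ∫⁻ x, ENNReal.ofReal (J x) * f (Ψ x) := by
    intro f
    have h := lintegral_image_eq_lintegral_abs_det_fderiv_mul volume MeasurableSet.univ
      (fun x _ => (hd x).hasFDerivWithinAt) hbij.injective.injOn f
    rw [image_univ, hbij.surjective.range_eq, setLIntegral_univ, setLIntegral_univ] at h
    simpa only [hdet, abs_of_nonneg (hJ0 _)] using h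
  have hk : Measurable fun p : EuclideanSpace ℝ (Fin n) × EuclideanSpace ℝ (Fin n) =>
      ENNReal.ofReal (K (p.1 - p.2)) := (hK.comp (by fun_prop)).ennreal_ofReal
  have hk' : Measurable fun p : EuclideanSpace ℝ (Fin n) × EuclideanSpace ℝ (Fin n) =>
      ENNReal.ofReal (K (Ψ p.1 - Ψ p.2) * (J p.1 * J p.2)) := by
    have h1 : Measurable fun p : EuclideanSpace ℝ (Fin n) × EuclideanSpace ℝ (Fin n) =>
      K (Ψ p.1 - Ψ p.2) := hK.comp (by fun_prop)
    fun_prop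
  have hS := measurableSet_interfacePairs hΩ hE
  have hS' := measurableSet_interfacePairs hΩ hEm
  rw [nonlocalPerimeter_eq_setLIntegral hK.aemeasurable hΩ hEm, ← lintegral_indicator hS,
    ← lintegral_indicator hS', Measure.volume_eq_prod,
    lintegral_prod _ (hk.indicator hS').aemeasurable,
    lintegral_prod _ (hk'.indicator hS).aemeasurable, hcv]
  refine lintegral_congr fun x => ?_
  rw [hcv, ← lintegral_const_mul' _ _ ENNReal.ofReal_ne_top]
  refine lintegral_congr fun y => ?_
  have hiff : (Ψ x, Ψ y) ∈ interfacePairs Ω (Ψ '' E) ↔ (x, y) ∈ interfacePairs Ω E := by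
    simp only [interfacePairs, mem_ofPred_eq, hbij.injective.mem_set_image, hmem]
  by_cases hxy : (x, y) ∈ interfacePairs Ω E
  · rw [indicator_of_mem hxy, indicator_of_mem (hiff.2 hxy), ENNReal.ofReal_mul'
      (mul_nonneg (hJ0 x) (hJ0 y)), ENNReal.ofReal_mul (hJ0 x)]
    ring
  · rw [indicator_of_notMem hxy, indicator_of_notMem (fun h => hxy (hiff.1 h))]
    simp

/-! ### Second-order estimates in one real variable. -/

theorem sub_linear_le_of_second_deriv_le {f f' f'' : ℝ → ℝ} {M T : ℝ}
    (hf : ∀ s, 0 ≤ s → s ≤ T → HasDerivAt f (f' s) s)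
    (hf' : ∀ s, 0 ≤ s → s ≤ T → HasDerivAt f' (f'' s) s)
    (hM : ∀ s, 0 ≤ s → s ≤ T → |f'' s| ≤ M) {t : ℝ} (h0 : 0 ≤ t) (ht : t ≤ T) :
    f t - f 0 - t * f' 0 ≤ M * t ^ 2 / 2 := by
  have hmono1 : MonotoneOn (fun s => M * s - f' s) (Icc 0 T) := by
    have hd : ∀ s ∈ Icc 0 T, HasDerivAt (fun s => M * s - f' s) (M - f'' s) s := fun s hs => by
      simpa using ((hasDerivAt_id' s).const_mul M).fun_sub (hf' s hs.1 hs.2)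
    refine monotoneOn_of_deriv_nonneg (convex_Icc 0 T)
      (fun s hs => (hd s hs).continuousAt.continuousWithinAt)
      (fun s hs => (hd s (interior_subset hs)).differentiableAt.differentiableWithinAt) ?_
    intro s hs
    have hs' := interior_subset hs
    rw [(hd s hs').deriv]
    linarith [le_abs_self (f'' s), hM s hs'.1 hs'.2]
  have hmono2 : MonotoneOn (fun s => M * s ^ 2 / 2 - (f s - s * f' 0)) (Icc 0 T) := by
    have hd : ∀ s ∈ Icc 0 T,
        HasDerivAt (fun s => M * s ^ 2 / 2 - (f s - s * f' 0)) (M * s - (f' s - f' 0)) s := by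
      intro s hs
      have h := ((((hasDerivAt_id' s).pow 2).const_mul M).div_const 2).fun_sub
        ((hf s hs.1 hs.2).fun_sub ((hasDerivAt_id' s).mul_const (f' 0)))
      refine h.congr_deriv ?_
      push_cast
      ring
    refine monotoneOn_of_deriv_nonneg (convex_Icc 0 T)
      (fun s hs => (hd s hs).continuousAt.continuousWithinAt)
      (fun s hs => (hd s (interior_subset hs)).differentiableAt.differentiableWithinAt) ?_
    intro s hs
    have hs' := interior_subset hs
    rw [(hd s hs').deriv]
    have := hmono1 (left_mem_Icc.2 (hs'.1.trans hs'.2)) hs' hs'.1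
    simp only [mul_zero] at this
    linarith
  have := hmono2 (left_mem_Icc.2 (h0.trans ht)) ⟨h0, ht⟩ h0
  simp only at this
  linarith

theorem abs_sub_linear_le_of_second_deriv_le {f f' f'' : ℝ → ℝ} {M T : ℝ}
    (hf : ∀ s, |s| ≤ T → HasDerivAt f (f' s) s)
    (hf' : ∀ s, |s| ≤ T → HasDerivAt f' (f'' s) s)
    (hM : ∀ s, |s| ≤ T → |f'' s| ≤ M) {t : ℝ} (ht : |t| ≤ T) :
    |f t - f 0 - t * f' 0| ≤ M * t ^ 2 / 2 := by
  -- The sign σ selects the upper or lower bound and τ the side of the origin, reducing all four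
  -- cases to the one-sided estimate.
  have key : ∀ σ τ : ℝ, |σ| = 1 → |τ| = 1 →
      σ * f (τ * |t|) - σ * f 0 - |t| * (σ * τ * f' 0) ≤ M * t ^ 2 / 2 := by
    intro σ τ hσ hτ
    have hτs : ∀ s, 0 ≤ s → |τ * s| = s := fun s hs => by
      rw [abs_mul, hτ, one_mul, abs_of_nonneg hs]
    have hl : ∀ s : ℝ, HasDerivAt (fun s => τ * s) τ s := fun s => by
      simpa using (hasDerivAt_id' s).const_mul τ
    have h := sub_linear_le_of_second_deriv_le (f := fun s => σ * f (τ * s))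
      (f' := fun s => σ * τ * f' (τ * s)) (f'' := fun s => σ * (τ * τ) * f'' (τ * s)) (M := M)
      (T := T) (fun s h0 hs => ?_) (fun s h0 hs => ?_) (fun s h0 hs => ?_) (abs_nonneg t) ht
    · simpa using h
    · have := ((hf (τ * s) (by rwa [hτs s h0])).comp s (hl s)).const_mul σ
      exact this.congr_deriv (by ring)
    · have := ((hf' (τ * s) (by rwa [hτs s h0])).comp s (hl s)).const_mul (σ * τ)
      exact this.congr_deriv (by ring)
    · rw [abs_mul, abs_mul, abs_mul, hσ, hτ]
      simpa using hM (τ * s) (by rwa [hτs s h0])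
  rw [abs_le]
  rcases abs_cases t with ⟨h, _⟩ | ⟨h, _⟩
  · have k1 := key 1 1 (by simp) (by simp)
    have k2 := key (-1) 1 (by simp) (by simp)
    rw [h] at k1 k2
    simp only [one_mul] at k1 k2
    constructor <;> linarith
  · have k1 := key 1 (-1) (by simp) (by simp)
    have k2 := key (-1) (-1) (by simp) (by simp)
    rw [h] at k1 k2
    simp only [neg_mul_neg, one_mul] at k1 k2
    constructor <;> linarith

/-- The symmetric sum kills every term odd in t. The 5 is 4 + 1: the cross term 2t²(a + b)d gives
4L²κ and the two Taylor remainders give L²κ; the remaining parts of the coefficient come from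
remainders times Jacobian terms. The product ab f₀ is kept apart because f₀ is not bounded by κ. -/
theorem weighted_second_difference_le {f₀ fp fm d κ t a b L : ℝ}
    (hp : |fp - f₀ - t * d| ≤ L ^ 2 * κ * t ^ 2 / 2)
    (hm : |fm - f₀ - -t * d| ≤ L ^ 2 * κ * t ^ 2 / 2)
    (hd : |d| ≤ L * κ) (ha : |a| ≤ L) (hb : |b| ≤ L) (hκ : 0 ≤ κ) :
    fp * ((1 + t * a) * (1 + t * b)) + fm * ((1 + -t * a) * (1 + -t * b))
      ≤ 2 * f₀ + t ^ 2 * (L ^ 2 * (5 + t ^ 2 * L ^ 2 + 2 * |t| * L) * κ)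
        + t ^ 2 * (2 * (a * b) * f₀) := by
  have hL : 0 ≤ L := (abs_nonneg _).trans ha
  set e₁ := fp - f₀ - t * d with he₁
  set e₂ := fm - f₀ - -t * d with he₂
  have hab : |a * b| ≤ L * L := by rw [abs_mul]; exact mul_le_mul ha hb (abs_nonneg _) hL
  have hapb : |a + b| ≤ 2 * L := (abs_add_le _ _).trans (by linarith)
  have hM : 0 ≤ L ^ 2 * κ * t ^ 2 := by positivity
  have hs : |e₁ + e₂| ≤ L ^ 2 * κ * t ^ 2 := (abs_add_le _ _).trans (by linarith)
  have hdf : |e₁ - e₂| ≤ L ^ 2 * κ * t ^ 2 := (abs_sub _ _).trans (by linarith)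
  have t1 : (1 + t ^ 2 * (a * b)) * (e₁ + e₂)
      ≤ (1 + t ^ 2 * (L * L)) * (L ^ 2 * κ * t ^ 2) := by
    refine (le_abs_self _).trans ?_
    rw [abs_mul]
    refine mul_le_mul ?_ hs (abs_nonneg _) (by positivity)
    refine (abs_add_le _ _).trans ?_
    rw [abs_one, abs_mul, abs_of_nonneg (sq_nonneg t)]
    gcongr
  have t2 : (a + b) * d ≤ 2 * L * (L * κ) := by
    refine (le_abs_self _).trans ?_
    rw [abs_mul]
    exact mul_le_mul hapb hd (abs_nonneg _) (by positivity)
  have t3 : t * (a + b) * (e₁ - e₂) ≤ |t| * (2 * L) * (L ^ 2 * κ * t ^ 2) := by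
    refine (le_abs_self _).trans ?_
    rw [abs_mul, abs_mul]
    refine mul_le_mul ?_ hdf (abs_nonneg _) (by positivity)
    gcongr
  have hfp : fp = f₀ + t * d + e₁ := by rw [he₁]; ring
  have hfm : fm = f₀ - t * d + e₂ := by rw [he₂]; ring
  have t2' : t ^ 2 * ((a + b) * d) ≤ t ^ 2 * (2 * L * (L * κ)) := by gcongr
  rw [hfp, hfm]
  nlinarith [t1, t2', t3]

/-! ### Shift profiles and the second variation of the perimeter. -/

/-- A cutoff equal to one slightly beyond the unit ball and supported inside the ball of radius
four, with a small Lipschitz constant. -/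
structure IsShiftProfile (φ : EuclideanSpace ℝ (Fin n) → ℝ) : Prop where
  contDiff : ContDiff ℝ 2 φ
  lipschitz : LipschitzWith (4 / 11) φ
  eq_zero : ∀ x, 39 / 10 ≤ ‖x‖ → φ x = 0
  eq_one : ∀ x, ‖x‖ ≤ 21 / 20 → φ x = 1

theorem exists_isShiftProfile (n : ℕ) :
    ∃ φ : EuclideanSpace ℝ (Fin n) → ℝ, IsShiftProfile φ := by
  -- The ramp falls from 1 at radius 11/10 to 0 at radius 77/20, a width of 11/4, hence the slope
  -- 4/11. Mollifying at scale 1/20 preserves the slope and moves the radii to 21/20 and 39/10.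
  set ψ : EuclideanSpace ℝ (Fin n) → ℝ := fun x => max 0 (min 1 (4 / 11 * (77 / 20 - ‖x‖)))
    with hψ
  have hψlip : LipschitzWith (4 / 11) ψ := by
    have h1 : LipschitzWith (4 / 11) fun x : EuclideanSpace ℝ (Fin n) =>
        4 / 11 * (77 / 20 - ‖x‖) := by
      refine LipschitzWith.of_dist_le_mul fun x y => ?_
      rw [Real.dist_eq, ← mul_sub, abs_mul, abs_of_pos (by norm_num : (0 : ℝ) < 4 / 11),
        dist_eq_norm]
      have : |77 / 20 - ‖x‖ - (77 / 20 - ‖y‖)| ≤ ‖x - y‖ := by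
        rw [show 77 / 20 - ‖x‖ - (77 / 20 - ‖y‖) = -(‖x‖ - ‖y‖) by ring, abs_neg]
        exact abs_norm_sub_norm_le x y
      have hc : ((4 / 11 : NNReal) : ℝ) = 4 / 11 := by norm_num
      rw [hc]
      gcongr
    exact (h1.const_min 1).const_max 0
  let ρ : ContDiffBump (0 : EuclideanSpace ℝ (Fin n)) :=
    ⟨1 / 40, 1 / 20, by norm_num, by norm_num⟩
  have hρout : ρ.rOut = 1 / 20 := rfl
  set φ := MeasureTheory.convolution (ρ.normed volume) ψ (ContinuousLinearMap.lsmul ℝ ℝ) volume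
    with hφ
  have hψc : Continuous ψ := hψlip.continuous
  have heq : ∀ x, φ x = ∫ s, ρ.normed volume s * ψ (x - s) := fun x => rfl
  have hint : ∀ x, Integrable fun s => ρ.normed volume s * ψ (x - s) := by
    intro x
    have hc : Continuous fun s => ρ.normed volume s * ψ (x - s) :=
      ρ.continuous_normed.mul (hψc.comp (by fun_prop))
    exact hc.integrable_of_hasCompactSupport ρ.hasCompactSupport_normed.mul_right
  refine ⟨φ, ?_, ?_, ?_, ?_⟩
  · exact ρ.hasCompactSupport_normed.contDiff_convolution_left _ ρ.contDiff_normed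
      hψc.locallyIntegrable
  · refine LipschitzWith.of_dist_le_mul fun x y => ?_
    rw [Real.dist_eq, heq, heq, ← integral_sub (hint x) (hint y), ← Real.norm_eq_abs]
    calc ‖∫ s, (ρ.normed volume s * ψ (x - s) - ρ.normed volume s * ψ (y - s))‖
        ≤ ∫ s, ρ.normed volume s * (((4 / 11 : NNReal) : ℝ) * dist x y) := by
          refine norm_integral_le_of_norm_le (ρ.integrable_normed.mul_const _)
            (Eventually.of_forall fun s => ?_)
          rw [← mul_sub, norm_mul, Real.norm_of_nonneg (ρ.nonneg_normed s)]
          refine mul_le_mul_of_nonneg_left ?_ (ρ.nonneg_normed s)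
          have := hψlip.dist_le_mul (x - s) (y - s)
          rwa [dist_sub_right, Real.dist_eq, ← Real.norm_eq_abs] at this
      _ = _ := by rw [integral_mul_const, ρ.integral_normed, one_mul]
  · intro x hx
    have h0 : ∀ y, 77 / 20 ≤ ‖y‖ → ψ y = 0 := fun y hy => by
      rw [hψ]
      exact max_eq_left (min_le_of_right_le (by linarith))
    rw [hφ, ρ.normed_convolution_eq_right]
    · exact h0 x (by linarith)
    · intro y hy
      rw [mem_ball_iff_norm, hρout] at hy
      have := norm_sub_norm_le x y
      rw [norm_sub_rev] at this
      rw [h0 x (by linarith), h0 y (by linarith)]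
  · intro x hx
    have h1 : ∀ y, ‖y‖ ≤ 11 / 10 → ψ y = 1 := fun y hy => by
      rw [hψ]
      simp only
      rw [min_eq_left (by linarith), max_eq_right zero_le_one]
    rw [hφ, ρ.normed_convolution_eq_right]
    · exact h1 x (by linarith)
    · intro y hy
      rw [mem_ball_iff_norm, hρout] at hy
      have := norm_sub_norm_le y x
      rw [h1 x (by linarith), h1 y (by linarith)]

/-- The map moving `x` by `t φ(x)` in the direction `v`. -/
noncomputable def shiftMap (φ : EuclideanSpace ℝ (Fin n) → ℝ) (v : EuclideanSpace ℝ (Fin n))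
    (t : ℝ) (x : EuclideanSpace ℝ (Fin n)) : EuclideanSpace ℝ (Fin n) :=
  x + (t * φ x) • v

namespace IsShiftProfile

variable {φ : EuclideanSpace ℝ (Fin n) → ℝ} {v : EuclideanSpace ℝ (Fin n)} {t : ℝ}

theorem abs_sub_le (hφ : IsShiftProfile φ) (x y : EuclideanSpace ℝ (Fin n)) :
    |φ x - φ y| ≤ 4 / 11 * ‖x - y‖ := by
  simpa using hφ.lipschitz.norm_sub_le x y

theorem abs_fderiv_le (hφ : IsShiftProfile φ) (hv : ‖v‖ = 1) (x : EuclideanSpace ℝ (Fin n)) :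
    |fderiv ℝ φ x v| ≤ 4 / 11 := by
  have h := (fderiv ℝ φ x).le_of_opNorm_le (norm_fderiv_le_of_lipschitz ℝ hφ.lipschitz) v
  simpa [hv] using h

theorem fderiv_eq_zero (hφ : IsShiftProfile φ) {x : EuclideanSpace ℝ (Fin n)}
    (hx : x ∉ Metric.ball (0 : EuclideanSpace ℝ (Fin n)) 4) : fderiv ℝ φ x = 0 := by
  rw [mem_ball_zero_iff, not_lt] at hx
  have hev : φ =ᶠ[𝓝 x] fun _ => 0 := by
    filter_upwards [(continuous_norm.isOpen_preimage _ isOpen_Ioi).mem_nhds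
      (show x ∈ norm ⁻¹' Ioi (39 / 10 : ℝ) by rw [mem_preimage, mem_Ioi]; linarith)] with y hy
    exact hφ.eq_zero y (le_of_lt hy)
  rw [hev.fderiv_eq, fderiv_fun_const]
  rfl

theorem shiftMap_bijective (hφ : IsShiftProfile φ) (hv : ‖v‖ = 1) (ht : |t| ≤ 1) :
    Function.Bijective (shiftMap φ v t) := by
  have hlip : LipschitzWith (4 / 11) fun x => shiftMap φ v t x - x := by
    refine LipschitzWith.of_dist_le_mul fun x y => ?_
    have hc : ((4 / 11 : NNReal) : ℝ) = 4 / 11 := by norm_num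
    rw [dist_eq_norm, dist_eq_norm, hc]
    simp only [shiftMap, add_sub_cancel_left]
    rw [← sub_smul, ← mul_sub, norm_smul, hv, mul_one, Real.norm_eq_abs, abs_mul]
    calc |t| * |φ x - φ y| ≤ 1 * |φ x - φ y| := by gcongr
      _ ≤ _ := by rw [one_mul]; exact hφ.abs_sub_le x y
  obtain ⟨h, hh⟩ := exists_homeomorph_of_lipschitz_sub_id (by
    rw [← NNReal.coe_lt_coe]; norm_num) hlip
  rw [← hh]
  exact h.bijective

theorem shiftMap_eq_self (hφ : IsShiftProfile φ) {x : EuclideanSpace ℝ (Fin n)}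
    (hx : x ∉ Metric.ball (0 : EuclideanSpace ℝ (Fin n)) 4) : shiftMap φ v t x = x := by
  rw [mem_ball_zero_iff, not_lt] at hx
  simp [shiftMap, hφ.eq_zero x (by linarith)]

theorem shiftMap_mem_ball_iff (hφ : IsShiftProfile φ) (hv : ‖v‖ = 1) (ht : |t| ≤ 1)
    (x : EuclideanSpace ℝ (Fin n)) :
    shiftMap φ v t x ∈ Metric.ball (0 : EuclideanSpace ℝ (Fin n)) 4
      ↔ x ∈ Metric.ball (0 : EuclideanSpace ℝ (Fin n)) 4 := by
  constructor
  · intro h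
    by_contra hx
    rw [hφ.shiftMap_eq_self hx] at h
    exact hx h
  · intro h
    by_contra hx
    have h2 := hφ.shiftMap_eq_self (v := v) (t := t) hx
    rw [(hφ.shiftMap_bijective hv ht).injective h2] at hx
    exact hx h

theorem hasFDerivAt_shiftMap (hφ : IsShiftProfile φ) (v : EuclideanSpace ℝ (Fin n)) (t : ℝ)
    (x : EuclideanSpace ℝ (Fin n)) :
    HasFDerivAt (shiftMap φ v t) (ContinuousLinearMap.id ℝ (EuclideanSpace ℝ (Fin n))
      + (t • fderiv ℝ φ x).smulRight v) x :=
  (hasFDerivAt_id x).add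
    (((hφ.contDiff.differentiable (by norm_num) x).hasFDerivAt.const_mul t).smul_const v)

/-- The derivative is a rank-one perturbation of the identity, so the Jacobian is exactly affine in
t. -/
theorem det_fderiv_shiftMap (φ : EuclideanSpace ℝ (Fin n) → ℝ) (v : EuclideanSpace ℝ (Fin n))
    (t : ℝ) (x : EuclideanSpace ℝ (Fin n)) :
    (ContinuousLinearMap.id ℝ (EuclideanSpace ℝ (Fin n))
      + (t • fderiv ℝ φ x).smulRight v).det = 1 + t * fderiv ℝ φ x v := by
  have h := LinearMap.transvection.det (R := ℝ) (V := EuclideanSpace ℝ (Fin n))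
    ((t • fderiv ℝ φ x : EuclideanSpace ℝ (Fin n) →L[ℝ] ℝ) : EuclideanSpace ℝ (Fin n) →ₗ[ℝ] ℝ) v
  rw [ContinuousLinearMap.det]
  exact h

theorem nonlocalPerimeter_shiftMap_image {K : EuclideanSpace ℝ (Fin n) → ℝ} (hK : Measurable K)
    (hφ : IsShiftProfile φ) (hv : ‖v‖ = 1) (ht : |t| ≤ 1) {E : Set (EuclideanSpace ℝ (Fin n))}
    (hE : MeasurableSet E) :
    nonlocalPerimeter K (Metric.ball 0 4) (shiftMap φ v t '' E)
      = ∫⁻ p in interfacePairs (Metric.ball 0 4) E,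
        ENNReal.ofReal (K (shiftMap φ v t p.1 - shiftMap φ v t p.2)
          * ((1 + t * fderiv ℝ φ p.1 v) * (1 + t * fderiv ℝ φ p.2 v))) := by
  refine nonlocalPerimeter_image hK measurableSet_ball hE (hφ.shiftMap_bijective hv ht)
    (hφ.hasFDerivAt_shiftMap v t) (hφ.shiftMap_mem_ball_iff hv ht)
    (J := fun x => 1 + t * fderiv ℝ φ x v) ?_ (fun x => ?_)
    (fun x => det_fderiv_shiftMap φ v t x)
  · have := measurable_fderiv_apply_const ℝ φ v
    fun_prop
  · have h1 := hφ.abs_fderiv_le hv x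
    have h2 : |t * fderiv ℝ φ x v| ≤ 1 := by
      rw [abs_mul]
      exact mul_le_one₀ ht (abs_nonneg _) (h1.trans (by norm_num))
    linarith [(abs_le.1 h2).1]

/-- The difference of two shifted points moves along a segment in direction v with speed |φ(x) -
φ(y)| ≤ 4/11 |x - y|. Each derivative of K along it gains a factor |x - y|, matching the weights in
the bounds by K*. -/
theorem kernel_second_difference_le {K Kstar : EuclideanSpace ℝ (Fin n) → ℝ}
    (hK : IsAdmissibleKernel K Kstar) (hφ : IsShiftProfile φ) (hv : ‖v‖ = 1) (ht : |t| ≤ 1 / 2)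
    {x y : EuclideanSpace ℝ (Fin n)} (hxy : x ≠ y) :
    K (shiftMap φ v t x - shiftMap φ v t y)
          * ((1 + t * fderiv ℝ φ x v) * (1 + t * fderiv ℝ φ y v))
        + K (shiftMap φ v (-t) x - shiftMap φ v (-t) y)
          * ((1 + -t * fderiv ℝ φ x v) * (1 + -t * fderiv ℝ φ y v))
      ≤ 2 * K (x - y) + 18 / 25 * t ^ 2 * Kstar (x - y)
        + t ^ 2 * (2 * (fderiv ℝ φ x v * fderiv ℝ φ y v) * K (x - y)) := by
  set z := x - y with hz
  have hz0 : z ≠ 0 := sub_ne_zero.2 hxy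
  have hzpos : 0 < ‖z‖ := norm_pos_iff.2 hz0
  set w := φ x - φ y with hw
  have hwz : |w| ≤ 4 / 11 * ‖z‖ := hφ.abs_sub_le x y
  have hκ : 0 ≤ Kstar z := hK.star_nonneg hz0
  have hsh : ∀ s : ℝ, shiftMap φ v s x - shiftMap φ v s y = z + s • (w • v) := by
    intro s
    simp only [shiftMap, hz, hw]
    module
  -- Since 4/11 < 1/2, the segment stays where the second-derivative bound at z applies and avoids
  -- the singularity.
  have hnear : ∀ s : ℝ, |s| ≤ 1 → ‖s • (w • v)‖ ≤ ‖z‖ / 2 := by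
    intro s hs
    rw [norm_smul, norm_smul, hv, mul_one, Real.norm_eq_abs, Real.norm_eq_abs]
    calc |s| * |w| ≤ 1 * (4 / 11 * ‖z‖) := by gcongr
      _ ≤ _ := by linarith
  have hne : ∀ s : ℝ, |s| ≤ 1 → z + s • (w • v) ≠ 0 := by
    intro s hs h0
    have h1 : s • (w • v) = -z := by rw [eq_neg_iff_add_eq_zero, add_comm, h0]
    have h2 := hnear s hs
    rw [h1, norm_neg] at h2
    linarith
  have hline : ∀ s : ℝ, HasDerivAt (fun s : ℝ => z + s • (w • v)) (w • v) s := fun s => by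
    simpa using ((hasDerivAt_id s).smul_const (w • v)).const_add z
  have hf1 : ∀ s : ℝ, |s| ≤ 1 → HasDerivAt (fun s : ℝ => K (z + s • (w • v)))
      (fderiv ℝ K (z + s • (w • v)) (w • v)) s := fun s hs =>
    (hK.differentiableAt _ (hne s hs)).hasFDerivAt.comp_hasDerivAt s (hline s)
  have hf2 : ∀ s : ℝ, |s| ≤ 1 → HasDerivAt (fun s : ℝ => fderiv ℝ K (z + s • (w • v)) (w • v))
      (fderiv ℝ (fderiv ℝ K) (z + s • (w • v)) (w • v) (w • v)) s := fun s hs =>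
    hasDerivAt_fderiv_apply_comp (hK.differentiableAt_fderiv _ (hne s hs)) (hline s)
  have hM : ∀ s : ℝ, |s| ≤ 1 →
      |fderiv ℝ (fderiv ℝ K) (z + s • (w • v)) (w • v) (w • v)| ≤ (4 / 11) ^ 2 * Kstar z := by
    intro s hs
    have h := hK.second_deriv_le z hz0 v hv (z + s • (w • v))
      (by rw [add_sub_cancel_left]; exact hnear s hs)
    simp only [map_smul, smul_apply, smul_eq_mul, abs_mul]
    have h2 : |w| * |w| ≤ (4 / 11 * ‖z‖) * (4 / 11 * ‖z‖) :=
      mul_le_mul hwz hwz (abs_nonneg _) (by positivity)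
    rw [← mul_assoc]
    calc |w| * |w| * |fderiv ℝ (fderiv ℝ K) (z + s • w • v) v v|
        ≤ (4 / 11 * ‖z‖) * (4 / 11 * ‖z‖) * |fderiv ℝ (fderiv ℝ K) (z + s • w • v) v v| := by
          gcongr
      _ = (4 / 11) ^ 2 * (‖z‖ ^ 2 * |fderiv ℝ (fderiv ℝ K) (z + s • w • v) v v|) := by ring
      _ ≤ _ := by gcongr
  have ht1 : |t| ≤ 1 := by linarith
  have hp := abs_sub_linear_le_of_second_deriv_le hf1 hf2 hM ht1
  have hm := abs_sub_linear_le_of_second_deriv_le hf1 hf2 hM (t := -t) (by rwa [abs_neg])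
  simp only [zero_smul, add_zero] at hp hm
  rw [neg_sq] at hm
  have hd : |fderiv ℝ K z (w • v)| ≤ 4 / 11 * Kstar z := by
    rw [map_smul, smul_eq_mul, abs_mul]
    calc |w| * |fderiv ℝ K z v| ≤ (4 / 11 * ‖z‖) * |fderiv ℝ K z v| := by gcongr
      _ = 4 / 11 * (‖z‖ * |fderiv ℝ K z v|) := by ring
      _ ≤ _ := by
        have := hK.first_deriv_le z hz0 v hv
        gcongr
  have h := weighted_second_difference_le hp hm hd (hφ.abs_fderiv_le hv x)
    (hφ.abs_fderiv_le hv y) hκ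
  rw [hsh, hsh]
  refine h.trans ?_
  have ht2 : t ^ 2 ≤ 1 / 4 := by
    rw [← sq_abs]
    nlinarith [abs_nonneg t]
  -- With |t| ≤ 1/2 the left side is about 0.714.
  have hcoef : (4 / 11 : ℝ) ^ 2 * (5 + t ^ 2 * (4 / 11) ^ 2 + 2 * |t| * (4 / 11)) ≤ 18 / 25 := by
    nlinarith
  have : t ^ 2 * ((4 / 11) ^ 2 * (5 + t ^ 2 * (4 / 11) ^ 2 + 2 * |t| * (4 / 11)) * Kstar z)
      ≤ t ^ 2 * (18 / 25 * Kstar z) := by gcongr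
  linarith

/-- Integrating the pointwise bound leaves 18/25 from the terms carrying K* and 2(4/11)² ≤ 7/25 from
the one carrying K. The latter is converted by `IsAdmissibleKernel.interaction_inter_le`, and the
two fractions add up to 1. -/
theorem nonlocalPerimeter_second_difference_le {K Kstar : EuclideanSpace ℝ (Fin n) → ℝ}
    (hK : IsAdmissibleKernel K Kstar) (hn : 2 ≤ n) (hφ : IsShiftProfile φ) (hv : ‖v‖ = 1)
    (ht : |t| ≤ 1 / 2) {E : Set (EuclideanSpace ℝ (Fin n))} (hE : MeasurableSet E) :
    nonlocalPerimeter K (Metric.ball 0 4) (shiftMap φ v t '' E)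
        + nonlocalPerimeter K (Metric.ball 0 4) (shiftMap φ v (-t) '' E)
      ≤ 2 * nonlocalPerimeter K (Metric.ball 0 4) E
        + ENNReal.ofReal (t ^ 2) * nonlocalPerimeter Kstar (Metric.ball 0 4) E := by
  have hKm := hK.measurable
  set B : Set (EuclideanSpace ℝ (Fin n)) := Metric.ball 0 4 with hB
  have hBm : MeasurableSet B := measurableSet_ball
  have hS := measurableSet_interfacePairs hBm hE
  have hT : MeasurableSet ((E ∩ B) ×ˢ (Eᶜ ∩ B)) := (hE.inter hBm).prod (hE.compl.inter hBm)
  have ht1 : |t| ≤ 1 := by linarith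
  have hmF : ∀ s : ℝ, Measurable fun p : EuclideanSpace ℝ (Fin n) × EuclideanSpace ℝ (Fin n) =>
      ENNReal.ofReal (K (shiftMap φ v s p.1 - shiftMap φ v s p.2)
          * ((1 + s * fderiv ℝ φ p.1 v) * (1 + s * fderiv ℝ φ p.2 v))) := by
    intro s
    have h1 := measurable_fderiv_apply_const ℝ φ v
    have h2 : Measurable (shiftMap φ v s) := by
      have := hφ.contDiff.continuous
      unfold shiftMap
      fun_prop
    have h3 : Measurable fun p : EuclideanSpace ℝ (Fin n) × EuclideanSpace ℝ (Fin n) =>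
      K (shiftMap φ v s p.1 - shiftMap φ v s p.2) := hKm.comp (by fun_prop)
    have h4 : Measurable fun p : EuclideanSpace ℝ (Fin n) × EuclideanSpace ℝ (Fin n) =>
      fderiv ℝ φ p.1 v := h1.comp measurable_fst
    have h5 : Measurable fun p : EuclideanSpace ℝ (Fin n) × EuclideanSpace ℝ (Fin n) =>
      fderiv ℝ φ p.2 v := h1.comp measurable_snd
    fun_prop
  have hk : Measurable fun p : EuclideanSpace ℝ (Fin n) × EuclideanSpace ℝ (Fin n) =>
      ENNReal.ofReal (K (p.1 - p.2)) := (hKm.comp (by fun_prop)).ennreal_ofReal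
  have hks := aemeasurable_comp_sub hK.aemeasurable_star.ennreal_ofReal
  rw [nonlocalPerimeter_shiftMap_image hKm hφ hv ht1 hE,
    nonlocalPerimeter_shiftMap_image hKm hφ hv (by rwa [abs_neg]) hE,
    ← lintegral_add_left (hmF t)]
  have hpt : ∀ p ∈ interfacePairs B E,
      ENNReal.ofReal (K (shiftMap φ v t p.1 - shiftMap φ v t p.2)
          * ((1 + t * fderiv ℝ φ p.1 v) * (1 + t * fderiv ℝ φ p.2 v)))
        + ENNReal.ofReal (K (shiftMap φ v (-t) p.1 - shiftMap φ v (-t) p.2)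
          * ((1 + -t * fderiv ℝ φ p.1 v) * (1 + -t * fderiv ℝ φ p.2 v)))
      ≤ (2 * ENNReal.ofReal (K (p.1 - p.2))
          + ENNReal.ofReal (18 / 25 * t ^ 2) * ENNReal.ofReal (Kstar (p.1 - p.2)))
        + ENNReal.ofReal (7 / 25 * t ^ 2)
          * ((E ∩ B) ×ˢ (Eᶜ ∩ B)).indicator (fun p => ENNReal.ofReal (K (p.1 - p.2))) p := by
    rintro ⟨x, y⟩ ⟨hx, hy, -⟩
    have hxy : x ≠ y := fun h => hy (h ▸ hx)
    have hfac : ∀ s : ℝ, |s| ≤ 1 → ∀ x, 0 ≤ 1 + s * fderiv ℝ φ x v := by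
      intro s hs x
      have h2 : |s * fderiv ℝ φ x v| ≤ 1 := by
        rw [abs_mul]
        exact mul_le_one₀ hs (abs_nonneg _) ((hφ.abs_fderiv_le hv x).trans (by norm_num))
      linarith [(abs_le.1 h2).1]
    have hpos : ∀ s : ℝ, |s| ≤ 1 → 0 ≤ K (shiftMap φ v s x - shiftMap φ v s y)
          * ((1 + s * fderiv ℝ φ x v) * (1 + s * fderiv ℝ φ y v)) := by
      intro s hs
      refine mul_nonneg (hK.nonneg _ ?_) (mul_nonneg (hfac s hs x) (hfac s hs y))
      exact sub_ne_zero.2 fun h => hxy ((hφ.shiftMap_bijective hv hs).injective h)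
    have hK0 := hK.nonneg (x - y) (sub_ne_zero.2 hxy)
    have hKs0 := hK.star_nonneg (sub_ne_zero.2 hxy)
    rw [← ENNReal.ofReal_add (hpos t ht1) (hpos (-t) (by rwa [abs_neg]))]
    refine (ENNReal.ofReal_le_ofReal (kernel_second_difference_le hK hφ hv ht hxy)).trans ?_
    refine ENNReal.ofReal_add_le.trans (add_le_add (ENNReal.ofReal_add_le.trans ?_) ?_)
    · rw [ENNReal.ofReal_mul (by norm_num), ENNReal.ofReal_ofNat,
        ENNReal.ofReal_mul (by positivity)]
    · by_cases hmem : (x, y) ∈ (E ∩ B) ×ˢ (Eᶜ ∩ B)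
      · rw [indicator_of_mem hmem, ← ENNReal.ofReal_mul (by positivity)]
        refine ENNReal.ofReal_le_ofReal ?_
        have hab : fderiv ℝ φ x v * fderiv ℝ φ y v ≤ 4 / 11 * (4 / 11) := by
          refine (le_abs_self _).trans ?_
          rw [abs_mul]
          exact mul_le_mul (hφ.abs_fderiv_le hv x) (hφ.abs_fderiv_le hv y) (abs_nonneg _)
            (by norm_num)
        have : 2 * (fderiv ℝ φ x v * fderiv ℝ φ y v) ≤ 7 / 25 := by linarith
        calc t ^ 2 * (2 * (fderiv ℝ φ x v * fderiv ℝ φ y v) * K (x - y))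
            ≤ t ^ 2 * (7 / 25 * K (x - y)) := by gcongr
          _ = _ := by ring
      -- The K-term survives only when both points are in B, the region where the K-interaction is
      -- under control.
      · have h0 : fderiv ℝ φ x v * fderiv ℝ φ y v = 0 := by
          by_cases hxB : x ∈ B
          · have hyB : y ∉ B := fun h => hmem ⟨⟨hx, hxB⟩, hy, h⟩
            rw [hφ.fderiv_eq_zero hyB]; simp
          · rw [hφ.fderiv_eq_zero hxB]; simp
        rw [h0]
        simp
  refine (setLIntegral_mono' hS hpt).trans ?_
  rw [lintegral_add_right _ ((hk.indicator hT).const_mul _),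
    lintegral_add_left (hk.const_mul _), lintegral_const_mul _ hk,
    lintegral_const_mul'' _ hks.restrict, lintegral_const_mul _ (hk.indicator hT),
    ← nonlocalPerimeter_eq_setLIntegral hKm.aemeasurable hBm hE,
    ← nonlocalPerimeter_eq_setLIntegral hK.aemeasurable_star hBm hE, add_assoc]
  gcongr
  have hI : ∫⁻ p in interfacePairs B E, ((E ∩ B) ×ˢ (Eᶜ ∩ B)).indicator
      (fun p => ENNReal.ofReal (K (p.1 - p.2))) p ≤ nonlocalPerimeter Kstar B E := by
    refine le_trans ?_ (hK.interaction_inter_le hn hBm hE)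
    rw [interaction_eq_setLIntegral hKm.aemeasurable, ← lintegral_indicator hT]
    exact setLIntegral_le_lintegral _ _
  calc _ ≤ ENNReal.ofReal (18 / 25 * t ^ 2) * nonlocalPerimeter Kstar B E
        + ENNReal.ofReal (7 / 25 * t ^ 2) * nonlocalPerimeter Kstar B E := by gcongr
    _ = _ := by
      rw [← add_mul, ← ENNReal.ofReal_add (by positivity) (by positivity)]
      congr 2
      ring

end IsShiftProfile

/-! ### Displacements as integral flows of test fields. -/

theorem exists_continuousLinearEquiv_of_norm_sub_id_lt {V : Type*} [NormedAddCommGroup V]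
    [NormedSpace ℝ V] [CompleteSpace V] {D : V →L[ℝ] V}
    (h : ‖D - ContinuousLinearMap.id ℝ V‖ < 1) : ∃ D' : V ≃L[ℝ] V, (D' : V →L[ℝ] V) = D := by
  have h' : ‖(1 : V →L[ℝ] V) - D‖ < 1 := by rw [norm_sub_rev]; exact h
  refine ⟨ContinuousLinearEquiv.unitsEquiv ℝ V (Units.oneSub (1 - D) h'), ?_⟩
  ext x
  simp

/-- A time-dependent displacement of small slope is the integral flow of a test field. -/
theorem exists_isTestField_shift {φ : EuclideanSpace ℝ (Fin n) → ℝ} (hφ : IsShiftProfile φ)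
    {v : EuclideanSpace ℝ (Fin n)} (hv : ‖v‖ = 1) :
    ∃ c : ℝ, 0 < c ∧ ∃ X Ψ, IsTestField (Metric.ball (0 : EuclideanSpace ℝ (Fin n)) 4) X ∧
      IsIntegralFlow X Ψ ∧ ∀ t : ℝ, |t| ≤ 1 / 4 → Ψ t = shiftMap φ v (c * t) := by
  -- The time cutoff makes the field compactly supported in (-1, 1), yet leaves the displacement
  -- linear in t for |t| ≤ 1/4.
  let η : ContDiffBump (0 : ℝ) := ⟨1 / 4, 1 / 2, by norm_num, by norm_num⟩
  have hηin : η.rIn = 1 / 4 := rfl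
  have hηout : η.rOut = 1 / 2 := rfl
  set g : ℝ → ℝ := fun t => t * η t with hg
  have hgsm : ContDiff ℝ 3 g := contDiff_id.mul η.contDiff
  have hg' : ContDiff ℝ 2 (deriv g) := by
    have h3 : ContDiff ℝ (2 + 1) g := hgsm.of_le (by norm_num)
    exact (contDiff_succ_iff_deriv.1 h3).2.2
  have hgsupp : tsupport g ⊆ Icc (-(1 / 2)) (1 / 2) := by
    have h1 : tsupport g ⊆ tsupport η := tsupport_mul_subset_right
    rw [η.tsupport_eq, hηout, Real.closedBall_eq_Icc] at h1
    simpa using h1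
  have hφc : ∀ x, x ∉ Metric.closedBall (0 : EuclideanSpace ℝ (Fin n)) (39 / 10) → φ x = 0 := by
    intro x hx
    rw [mem_closedBall_zero_iff, not_le] at hx
    exact hφ.eq_zero x hx.le
  set F : EuclideanSpace ℝ (Fin n) × ℝ → ℝ := fun p => g p.2 * φ p.1 with hF
  have hFsm : ContDiff ℝ 2 F :=
    ((hgsm.of_le (by norm_num)).comp contDiff_snd).mul (hφ.contDiff.comp contDiff_fst)
  have hFc : HasCompactSupport F := by
    refine HasCompactSupport.intro
      ((isCompact_closedBall (0 : EuclideanSpace ℝ (Fin n)) (39 / 10)).prod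
        (isCompact_Icc (a := (-(1 / 2) : ℝ)) (b := 1 / 2))) fun p hp => ?_
    by_cases h1 : p.1 ∈ Metric.closedBall (0 : EuclideanSpace ℝ (Fin n)) (39 / 10)
    · have h2 : p.2 ∉ Icc (-(1 / 2) : ℝ) (1 / 2) := fun h => hp ⟨h1, h⟩
      have : g p.2 = 0 := image_eq_zero_of_notMem_tsupport fun h => h2 (hgsupp h)
      simp [hF, this]
    · simp [hF, hφc _ h1]
  obtain ⟨M, hM⟩ := hFsm.lipschitzWith_of_hasCompactSupport hFc (by norm_num)
  obtain ⟨M₀, hM₀⟩ := hFc.exists_bound_of_continuous hFsm.continuous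
  have hM₀nn : 0 ≤ M₀ := (norm_nonneg _).trans (hM₀ 0)
  -- Slowing time by c makes the space-time map a small perturbation of the identity and moves
  -- points by at most 1/20, so the support of the field stays within 39/10 + 1/20 = 79/20 < 4.
  set c : ℝ := (20 * (M + M₀ + 1))⁻¹ with hc
  have hMnn : (0 : ℝ) ≤ M := M.2
  have hcpos : 0 < c := by positivity
  have hcM : c * M ≤ 1 / 20 := by
    rw [hc, inv_mul_le_iff₀ (by positivity)]
    linarith
  have hcM₀ : c * M₀ ≤ 1 / 20 := by
    rw [hc, inv_mul_le_iff₀ (by positivity)]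
    linarith
  -- The maps x ↦ x + tφ(x)v do not form a one-parameter group, so the field must depend on time: it
  -- is the velocity at the starting point, recovered by inverting the space-time map, whose inverse
  -- is C².
  set Φ : EuclideanSpace ℝ (Fin n) × ℝ → EuclideanSpace ℝ (Fin n) × ℝ :=
    fun p => p + ((c * F p) • v, 0) with hΦ
  have hΦsm : ContDiff ℝ 2 Φ :=
    contDiff_id.add (((contDiff_const.mul hFsm).smul contDiff_const).prodMk contDiff_const)
  have hlip : LipschitzWith (1 / 2) fun p => Φ p - p := by
    refine LipschitzWith.of_dist_le_mul fun p q => ?_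
    have h2 : ((1 / 2 : NNReal) : ℝ) = 1 / 2 := by norm_num
    simp only [hΦ, add_sub_cancel_left]
    rw [Prod.dist_eq, dist_self, max_eq_left dist_nonneg, dist_eq_norm, ← sub_smul, ← mul_sub,
      norm_smul, hv, mul_one, norm_mul, Real.norm_of_nonneg hcpos.le, h2]
    have h3 := hM.norm_sub_le p q
    rw [← dist_eq_norm p q] at h3
    calc c * ‖F p - F q‖ ≤ c * (M * dist p q) := by gcongr
      _ = c * M * dist p q := by ring
      _ ≤ 1 / 2 * dist p q := by
        have := dist_nonneg (x := p) (y := q)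
        gcongr
        linarith
  obtain ⟨h, hh⟩ := exists_homeomorph_of_lipschitz_sub_id (by
    rw [← NNReal.coe_lt_coe]; norm_num) hlip
  have hD : ∀ p, ∃ D' : (EuclideanSpace ℝ (Fin n) × ℝ) ≃L[ℝ] (EuclideanSpace ℝ (Fin n) × ℝ),
      HasFDerivAt Φ (D' : EuclideanSpace ℝ (Fin n) × ℝ →L[ℝ] EuclideanSpace ℝ (Fin n) × ℝ) p := by
    intro p
    have hd : HasFDerivAt Φ (fderiv ℝ Φ p) p :=
      (hΦsm.differentiable (by norm_num) p).hasFDerivAt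
    have hd2 := hd.sub (hasFDerivAt_id p)
    have hnorm : ‖fderiv ℝ Φ p - ContinuousLinearMap.id ℝ _‖ ≤ (1 / 2 : NNReal) :=
      hd2.le_of_lipschitz hlip
    obtain ⟨D', hD'⟩ := exists_continuousLinearEquiv_of_norm_sub_id_lt
      (hnorm.trans_lt (by norm_num))
    exact ⟨D', by rw [hD']; exact hd⟩
  choose D' hD' using hD
  have hsymm : ContDiff ℝ 2 h.symm :=
    h.contDiff_symm (f₀' := D') (fun a => by rw [hh]; exact hD' a) (by rw [hh]; exact hΦsm)
  have hsymmΦ : ∀ p, h.symm (Φ p) = p := fun p => by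
    have := h.symm_apply_apply p
    rwa [hh] at this
  have hΦsymm : ∀ p, Φ (h.symm p) = p := fun p => by
    have := h.apply_symm_apply p
    rwa [hh] at this
  set X : EuclideanSpace ℝ (Fin n) × ℝ → EuclideanSpace ℝ (Fin n) :=
    fun p => (c * deriv g p.2 * φ (h.symm p).1) • v with hX
  set Ψ : ℝ → EuclideanSpace ℝ (Fin n) → EuclideanSpace ℝ (Fin n) :=
    fun t x => x + (c * (g t * φ x)) • v with hΨ
  have hXsupp : Function.support X ⊆
      Metric.closedBall (0 : EuclideanSpace ℝ (Fin n)) (79 / 20) ×ˢ Icc (-(1 / 2) : ℝ) (1 / 2) := by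
    intro p hp
    have hne : c * deriv g p.2 * φ (h.symm p).1 ≠ 0 := fun h0 => hp (by simp [hX, h0])
    have h1 : φ (h.symm p).1 ≠ 0 := right_ne_zero_of_mul hne
    have h2 : deriv g p.2 ≠ 0 := right_ne_zero_of_mul (left_ne_zero_of_mul hne)
    refine ⟨?_, hgsupp (support_deriv_subset h2)⟩
    have h3 : ‖(h.symm p).1‖ ≤ 39 / 10 := by
      by_contra hcon
      exact h1 (hφ.eq_zero _ (not_le.1 hcon).le)
    have h4 : p.1 = (h.symm p).1 + (c * F (h.symm p)) • v := by
      conv_lhs => rw [← hΦsymm p]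
      rfl
    rw [mem_closedBall_zero_iff, h4]
    refine (norm_add_le _ _).trans ?_
    rw [norm_smul, hv, mul_one, norm_mul, Real.norm_of_nonneg hcpos.le]
    have h5 : c * ‖F (h.symm p)‖ ≤ c * M₀ := by
      have := hM₀ (h.symm p)
      gcongr
    linarith
  have hcpt : IsCompact (Metric.closedBall (0 : EuclideanSpace ℝ (Fin n)) (79 / 20) ×ˢ
      Icc (-(1 / 2) : ℝ) (1 / 2)) := (isCompact_closedBall _ _).prod isCompact_Icc
  refine ⟨c, hcpos, X, Ψ, ⟨?_, ?_, ?_⟩, ?_, ?_⟩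
  · exact (((contDiff_const.mul (hg'.comp contDiff_snd)).mul
      (hφ.contDiff.comp (contDiff_fst.comp hsymm))).smul contDiff_const)
  · exact HasCompactSupport.of_support_subset_isCompact hcpt hXsupp
  · refine (closure_minimal hXsupp hcpt.isClosed).trans (prod_mono ?_ ?_)
    · exact Metric.closedBall_subset_ball (by norm_num)
    · exact Icc_subset_Ioo (by norm_num) (by norm_num)
  · intro x
    refine ⟨by simp [hΨ, hg], fun t _ => ?_⟩
    have h1 : X (Ψ t x, t) = (c * (deriv g t * φ x)) • v := by
      have h2 : (Ψ t x, t) = Φ (x, t) := by simp [hΦ, hΨ, hF]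
      simp only [hX]
      rw [h2, hsymmΦ]
      simp only [mul_assoc]
    rw [h1]
    have h3 : HasDerivAt g (deriv g t) t :=
      (hgsm.differentiable (by norm_num) t).hasDerivAt
    exact (((h3.mul_const (φ x)).const_mul c).smul_const v).const_add x
  · intro t ht
    have : η t = 1 := η.one_of_mem_closedBall (by
      rw [hηin, mem_closedBall_zero_iff]; exact ht)
    ext1 x
    simp only [hΨ, shiftMap, hg, this, one_mul, mul_assoc]

/-- Stability, tested on the displacements by a fixed profile. -/
theorem IsStableSet.shiftMap {K : EuclideanSpace ℝ (Fin n) → ℝ}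
    {E : Set (EuclideanSpace ℝ (Fin n))} (hE : IsStableSet K (Metric.ball 0 4) E)
    {φ : EuclideanSpace ℝ (Fin n) → ℝ} (hφ : IsShiftProfile φ)
    {v : EuclideanSpace ℝ (Fin n)} (hv : ‖v‖ = 1) {ε : ℝ} (hε : 0 < ε) :
    ∃ t₀ : ℝ, 0 < t₀ ∧ ∀ t : ℝ, |t| < t₀ →
      nonlocalPerimeter K (Metric.ball 0 4) E
          ≤ nonlocalPerimeter K (Metric.ball 0 4) (shiftMap φ v t '' E ∪ E)
            + ENNReal.ofReal (ε * t ^ 2) ∧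
      nonlocalPerimeter K (Metric.ball 0 4) E
          ≤ nonlocalPerimeter K (Metric.ball 0 4) (shiftMap φ v t '' E ∩ E)
            + ENNReal.ofReal (ε * t ^ 2) := by
  obtain ⟨c, hc, X, Ψ, hX, hΨ, hsh⟩ := exists_isTestField_shift hφ hv
  -- Stability is used at time t/c, so the tolerance is multiplied by c² in advance.
  obtain ⟨t₀, ht₀, -, hst⟩ := hE.2 X Ψ hX hΨ (ε * c ^ 2) (by positivity)
  refine ⟨c * min t₀ (1 / 4), by positivity, fun t ht => ?_⟩
  have habs : |t / c| < min t₀ (1 / 4) := by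
    rw [abs_div, abs_of_pos hc, div_lt_iff₀ hc, mul_comm]
    exact ht
  have h := hst (t / c) (habs.trans_le (min_le_left _ _))
  rw [hsh (t / c) (habs.le.trans (min_le_right _ _)), mul_div_cancel₀ t hc.ne'] at h
  have h2 : ε * c ^ 2 * (t / c) ^ 2 = ε * t ^ 2 := by field_simp
  rwa [h2] at h

/-! ### Null-set invariance, and the volumes gained and lost. -/

theorem interaction_congr {K : EuclideanSpace ℝ (Fin n) → ℝ}
    {A A' B B' : Set (EuclideanSpace ℝ (Fin n))} (hA : A =ᵐ[volume] A') (hB : B =ᵐ[volume] B') :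
    interaction K A B = interaction K A' B' := by
  simp only [interaction, Measure.restrict_congr_set hA, Measure.restrict_congr_set hB]

theorem nonlocalPerimeter_congr {K : EuclideanSpace ℝ (Fin n) → ℝ}
    {Ω E E' : Set (EuclideanSpace ℝ (Fin n))} (h : E =ᵐ[volume] E') :
    nonlocalPerimeter K Ω E = nonlocalPerimeter K Ω E' := by
  have h1 : (E ∩ Ω : Set _) =ᵐ[volume] (E' ∩ Ω : Set _) := h.inter (ae_eq_refl _)
  have h2 : (Eᶜ ∩ Ω : Set _) =ᵐ[volume] (E'ᶜ ∩ Ω : Set _) := h.compl.inter (ae_eq_refl _)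
  have h3 : (E \ Ω : Set _) =ᵐ[volume] (E' \ Ω : Set _) := h.diff (ae_eq_refl _)
  have h4 : (Eᶜ \ Ω : Set _) =ᵐ[volume] (E'ᶜ \ Ω : Set _) := h.compl.diff (ae_eq_refl _)
  rw [nonlocalPerimeter, nonlocalPerimeter, interaction_congr h1 h2, interaction_congr h1 h4,
    interaction_congr h3 h2]

theorem IsShiftProfile.shiftMap_image_congr {φ : EuclideanSpace ℝ (Fin n) → ℝ}
    (hφ : IsShiftProfile φ) {v : EuclideanSpace ℝ (Fin n)} (hv : ‖v‖ = 1) {t : ℝ} (ht : |t| ≤ 1)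
    {E E' : Set (EuclideanSpace ℝ (Fin n))} (h : E =ᵐ[volume] E') :
    (_root_.shiftMap φ v t '' E : Set _) =ᵐ[volume] (_root_.shiftMap φ v t '' E' : Set _) := by
  rw [← measure_symmDiff_eq_zero_iff, ← image_symmDiff (hφ.shiftMap_bijective hv ht).injective]
  refine addHaar_image_eq_zero_of_differentiableOn_of_addHaar_eq_zero volume
    (fun x _ => (hφ.hasFDerivAt_shiftMap v t x).differentiableAt.differentiableWithinAt) ?_
  exact measure_symmDiff_eq_zero_iff.2 h

/-- The points of the unit ball that enter `E` when `E` is translated by `a`. -/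
def gained (E : Set (EuclideanSpace ℝ (Fin n))) (a : EuclideanSpace ℝ (Fin n)) :
    Set (EuclideanSpace ℝ (Fin n)) :=
  {x | x ∈ Metric.ball 0 1 ∧ x ∉ E ∧ x - a ∈ E}

/-- The points of the unit ball that leave `E` when `E` is translated by `a`. -/
def lost (E : Set (EuclideanSpace ℝ (Fin n))) (a : EuclideanSpace ℝ (Fin n)) :
    Set (EuclideanSpace ℝ (Fin n)) :=
  {x | x ∈ Metric.ball 0 1 ∧ x ∈ E ∧ x - a ∉ E}

theorem measurableSet_gained {E : Set (EuclideanSpace ℝ (Fin n))} (hE : MeasurableSet E)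
    (a : EuclideanSpace ℝ (Fin n)) : MeasurableSet (gained E a) :=
  measurableSet_ball.inter (hE.compl.inter ((measurable_id.sub_const a) hE))

theorem measurableSet_lost {E : Set (EuclideanSpace ℝ (Fin n))} (hE : MeasurableSet E)
    (a : EuclideanSpace ℝ (Fin n)) : MeasurableSet (lost E a) :=
  measurableSet_ball.inter (hE.inter ((measurable_id.sub_const a) hE.compl))

/-- Two distinct points of B_1 are at distance less than 2, where K ≥ 1. -/
theorem volume_mul_volume_le_interaction {K Kstar : EuclideanSpace ℝ (Fin n) → ℝ}
    (hK : IsAdmissibleKernel K Kstar) {A B A' B' : Set (EuclideanSpace ℝ (Fin n))}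
    (hA : MeasurableSet A) (hB : MeasurableSet B) (hAB : Disjoint A B)
    (hA1 : A ⊆ Metric.ball 0 1) (hB1 : B ⊆ Metric.ball 0 1) (hAA' : A ⊆ A') (hBB' : B ⊆ B') :
    volume A * volume B ≤ interaction K A' B' := by
  rw [interaction_eq_setLIntegral hK.measurable.aemeasurable]
  refine le_trans ?_ (lintegral_mono_set (prod_mono hAA' hBB'))
  rw [← Measure.prod_prod, ← Measure.volume_eq_prod, ← setLIntegral_one]
  refine setLIntegral_mono' (hA.prod hB) ?_
  rintro ⟨x, y⟩ ⟨hx, hy⟩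
  have hxy : x - y ≠ 0 := sub_ne_zero.2 fun h => disjoint_left.1 hAB hx (h ▸ hy)
  have hx1 := mem_ball_zero_iff.1 (hA1 hx)
  have hy1 := mem_ball_zero_iff.1 (hB1 hy)
  have h := hK.one_le (x - y) hxy ((norm_sub_le x y).trans_lt (by simp only at *; linarith))
  simpa using h

/-- The products of the volumes gained and lost under a small translation are of second order. -/
theorem volume_gained_mul_lost_le {K Kstar : EuclideanSpace ℝ (Fin n) → ℝ}
    (hK : IsAdmissibleKernel K Kstar) (hn : 2 ≤ n) {E₀ E : Set (EuclideanSpace ℝ (Fin n))}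
    (hstable : IsStableSet K (Metric.ball 0 4) E₀) (hE : MeasurableSet E)
    (hEE : E₀ =ᵐ[volume] E) {v : EuclideanSpace ℝ (Fin n)} (hv : ‖v‖ = 1) {ε : ℝ} (hε : 0 < ε) :
    ∃ t₀ : ℝ, 0 < t₀ ∧ ∀ t : ℝ, |t| < t₀ →
      2 * (volume (gained E (t • v)) * volume (lost E (t • v)))
        ≤ ENNReal.ofReal (t ^ 2) * nonlocalPerimeter Kstar (Metric.ball 0 4) E
          + ENNReal.ofReal (ε * t ^ 2) := by
  obtain ⟨φ, hφ⟩ := exists_isShiftProfile n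
  obtain ⟨t₀, ht₀, hst⟩ := hstable.shiftMap hφ hv (ε := ε / 4) (by positivity)
  -- With |t| ≤ 1/20, points of B_1 come from radius at most 21/20, where the profile equals 1 and
  -- the displacement is a genuine translation.
  refine ⟨min t₀ (1 / 20), by positivity, fun t ht => ?_⟩
  have htt₀ : |t| < t₀ := ht.trans_le (min_le_left _ _)
  have ht20 : |t| ≤ 1 / 20 := (ht.trans_le (min_le_right _ _)).le
  have ht1 : |t| ≤ 1 := by linarith
  set B : Set (EuclideanSpace ℝ (Fin n)) := Metric.ball 0 4 with hB
  set P := nonlocalPerimeter K B E with hP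
  have hPfin : P ≠ ⊤ := by
    rw [hP, ← nonlocalPerimeter_congr hEE]
    exact hstable.1.ne
  set a := ENNReal.ofReal (ε / 4 * t ^ 2) with ha
  have hbij : ∀ s : ℝ, |s| ≤ 1 → Function.Bijective (shiftMap φ v s) := fun s hs =>
    hφ.shiftMap_bijective hv hs
  -- Stability of the union and of the intersection are added to submodularity; one copy of the
  -- finite number P then cancels.
  have hsub : ∀ s : ℝ, |s| < t₀ → |s| ≤ 1 → s ^ 2 = t ^ 2 →
      P + (interaction K (shiftMap φ v s '' E \ E) (E \ shiftMap φ v s '' E)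
          + interaction K (E \ shiftMap φ v s '' E) (shiftMap φ v s '' E \ E))
        ≤ nonlocalPerimeter K B (shiftMap φ v s '' E) + 2 * a := by
    intro s hs hs1 hst2
    set F := shiftMap φ v s '' E with hF
    have hFm : MeasurableSet F :=
      measurable_image_of_fderivWithin hE
        (fun x _ => (hφ.hasFDerivAt_shiftMap v s x).hasFDerivWithinAt) (hbij s hs1).injective.injOn
    have hFF : (shiftMap φ v s '' E₀ : Set _) =ᵐ[volume] F :=
      hφ.shiftMap_image_congr hv hs1 hEE
    obtain ⟨h1, h2⟩ := hst s hs
    rw [nonlocalPerimeter_congr hEE, nonlocalPerimeter_congr (hFF.union hEE), hst2] at h1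
    rw [nonlocalPerimeter_congr hEE, nonlocalPerimeter_congr (hFF.inter hEE), hst2] at h2
    have hEF : E \ F ⊆ B := by
      rintro x ⟨hx, hxF⟩
      by_contra hxB
      exact hxF ⟨x, hx, hφ.shiftMap_eq_self hxB⟩
    have hFE : F \ E ⊆ B := by
      rintro x ⟨⟨y, hy, rfl⟩, hxE⟩
      by_contra hxB
      have h3 := hφ.shiftMap_eq_self (v := v) (t := s) hxB
      rw [(hbij s hs1).injective h3] at hxE
      exact hxE hy
    have h3 := nonlocalPerimeter_union_add_inter_le hK.measurable measurableSet_ball hE hFm hEF hFE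
    set I := interaction K (F \ E) (E \ F) + interaction K (E \ F) (F \ E)
    refine (ENNReal.add_le_add_iff_left hPfin).1 ?_
    calc P + (P + I) ≤ (nonlocalPerimeter K B (F ∪ E) + a)
          + (nonlocalPerimeter K B (F ∩ E) + a + I) := by gcongr
      _ = nonlocalPerimeter K B (F ∪ E) + nonlocalPerimeter K B (F ∩ E) + I + 2 * a := by ring
      _ ≤ P + nonlocalPerimeter K B F + 2 * a := by gcongr
      _ = _ := by ring
  have hplus := hsub t htt₀ ht1 rfl
  -- For -t the surplus is discarded: only a lower bound completing the second difference is needed.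
  have hminus : P ≤ nonlocalPerimeter K B (shiftMap φ v (-t) '' E) + 2 * a :=
    le_trans le_self_add (hsub (-t) (by rwa [abs_neg]) (by rwa [abs_neg]) (neg_sq t))
  have hsd := hφ.nonlocalPerimeter_second_difference_le hK hn hv
    (show |t| ≤ 1 / 2 by linarith) hE
  set F := shiftMap φ v t '' E with hF
  set I := interaction K (F \ E) (E \ F) + interaction K (E \ F) (F \ E) with hI
  have hIle : I ≤ ENNReal.ofReal (t ^ 2) * nonlocalPerimeter Kstar B E
      + ENNReal.ofReal (ε * t ^ 2) := by
    have h4a : ENNReal.ofReal (ε * t ^ 2) = 4 * a := by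
      rw [ha, ← ENNReal.ofReal_ofNat 4, ← ENNReal.ofReal_mul (by norm_num)]
      congr 1
      ring
    rw [h4a]
    refine (ENNReal.add_le_add_iff_left (ENNReal.mul_ne_top (by simp : (2 : ENNReal) ≠ ⊤)
      hPfin)).1 ?_
    calc 2 * P + I = (P + I) + P := by ring
      _ ≤ (nonlocalPerimeter K B F + 2 * a)
          + (nonlocalPerimeter K B (shiftMap φ v (-t) '' E) + 2 * a) := by gcongr
      _ = (nonlocalPerimeter K B F + nonlocalPerimeter K B (shiftMap φ v (-t) '' E)) + 4 * a := by
          ring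
      _ ≤ _ := by
          rw [← add_assoc]
          gcongr
  refine le_trans ?_ hIle
  have hback : ∀ x ∈ Metric.ball (0 : EuclideanSpace ℝ (Fin n)) 1,
      shiftMap φ v t (x - t • v) = x := by
    intro x hx
    rw [mem_ball_zero_iff] at hx
    have h1 : ‖x - t • v‖ ≤ 21 / 20 := by
      refine (norm_sub_le _ _).trans ?_
      rw [norm_smul, hv, mul_one, Real.norm_eq_abs]
      linarith
    simp [shiftMap, hφ.eq_one _ h1]
  have hgain : gained E (t • v) ⊆ F \ E := fun x hx =>
    ⟨⟨x - t • v, hx.2.2, hback x hx.1⟩, hx.2.1⟩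
  have hlost : lost E (t • v) ⊆ E \ F := by
    refine fun x hx => ⟨hx.2.1, ?_⟩
    rintro ⟨y, hy, hyx⟩
    have := (hbij t ht1).injective (hyx.trans (hback x hx.1).symm)
    exact hx.2.2 (this ▸ hy)
  have hdisj : Disjoint (gained E (t • v)) (lost E (t • v)) :=
    disjoint_left.2 fun x hx hx' => hx.2.1 hx'.2.1
  have hgm := measurableSet_gained hE (t • v)
  have hlm := measurableSet_lost hE (t • v)
  rw [two_mul, hI]
  refine add_le_add ?_ ?_
  · exact volume_mul_volume_le_interaction hK hgm hlm hdisj (fun x hx => hx.1) (fun x hx => hx.1)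
      hgain hlost
  · rw [mul_comm]
    exact volume_mul_volume_le_interaction hK hlm hgm hdisj.symm (fun x hx => hx.1)
      (fun x hx => hx.1) hlost hgain

/-! ### The flux of a radial cutoff. -/

/-- A smooth radially decreasing cutoff of the unit ball, equal to one where `‖x‖² ≤ 1 - h`. -/
noncomputable def radialCutoff (n : ℕ) (h : ℝ) (x : EuclideanSpace ℝ (Fin n)) : ℝ :=
  Real.smoothTransition ((1 - ‖x‖ ^ 2) / h)

namespace radialCutoff

/-- The gradient of the radial cutoff at `x` is `-slope h ‖x‖ • x`. -/
noncomputable def slope (h r : ℝ) : ℝ := 2 / h * deriv Real.smoothTransition ((1 - r ^ 2) / h)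

variable {h : ℝ}

theorem contDiff (n : ℕ) (h : ℝ) : ContDiff ℝ 1 (radialCutoff n h) :=
  Real.smoothTransition.contDiff.comp ((contDiff_const.sub (contDiff_norm_sq ℝ)).div_const h)

theorem eq_zero (hh : 0 < h) {x : EuclideanSpace ℝ (Fin n)}
    (hx : x ∉ Metric.ball (0 : EuclideanSpace ℝ (Fin n)) 1) : radialCutoff n h x = 0 := by
  rw [mem_ball_zero_iff, not_lt] at hx
  refine Real.smoothTransition.zero_of_nonpos (div_nonpos_of_nonpos_of_nonneg ?_ hh.le)
  nlinarith

theorem eq_one (hh : 0 < h) {x : EuclideanSpace ℝ (Fin n)} (hx : ‖x‖ ^ 2 ≤ 1 - h) :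
    radialCutoff n h x = 1 := by
  refine Real.smoothTransition.one_of_one_le ?_
  rw [le_div_iff₀ hh]
  linarith

theorem hasCompactSupport (hh : 0 < h) : HasCompactSupport (radialCutoff n h) :=
  HasCompactSupport.intro (isCompact_closedBall (0 : EuclideanSpace ℝ (Fin n)) 1) fun _ hx =>
    eq_zero hh fun hx' => hx (Metric.ball_subset_closedBall hx')

theorem slope_nonneg (hh : 0 < h) (r : ℝ) : 0 ≤ slope h r :=
  mul_nonneg (by positivity) Real.smoothTransition.monotone.deriv_nonneg

theorem continuous_slope (h : ℝ) : Continuous (slope h) := by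
  have : Continuous (deriv Real.smoothTransition) :=
    (Real.smoothTransition.contDiff (n := 1)).continuous_deriv le_rfl
  unfold slope
  fun_prop

theorem slope_eq_zero (hh : 0 < h) {r : ℝ} (hr : 1 < r) : slope h r = 0 := by
  have hneg : (1 - r ^ 2) / h < 0 := div_neg_of_neg_of_pos (by nlinarith) hh
  have hev : Real.smoothTransition =ᶠ[𝓝 ((1 - r ^ 2) / h)] fun _ => 0 := by
    filter_upwards [gt_mem_nhds hneg] with y hy
    exact Real.smoothTransition.zero_of_nonpos (le_of_lt hy)
  rw [slope, hev.deriv_eq]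
  simp

theorem fderiv_apply_single (h : ℝ) (x : EuclideanSpace ℝ (Fin n)) (i : Fin n) :
    fderiv ℝ (radialCutoff n h) x (EuclideanSpace.single i 1) = -(slope h ‖x‖ * x i) := by
  have h1 : HasFDerivAt (fun x : EuclideanSpace ℝ (Fin n) => (1 - ‖x‖ ^ 2) / h)
      (h⁻¹ • -(2 • innerSL ℝ x) : EuclideanSpace ℝ (Fin n) →L[ℝ] ℝ) x := by
    simp only [div_eq_inv_mul]
    exact ((hasStrictFDerivAt_norm_sq x).hasFDerivAt.const_sub 1).const_mul h⁻¹
  have h2 : HasDerivAt Real.smoothTransition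
      (deriv Real.smoothTransition ((1 - ‖x‖ ^ 2) / h)) ((1 - ‖x‖ ^ 2) / h) :=
    ((Real.smoothTransition.contDiff (n := 1)).differentiable (by norm_num) _).hasDerivAt
  have h3 : HasFDerivAt (radialCutoff n h) _ x := h2.comp_hasFDerivAt x h1
  rw [h3.fderiv, slope]
  simp [EuclideanSpace.inner_single_right]
  ring

theorem integral_slope_mul_eq_one (hh : 0 < h) (h1 : h ≤ 1) :
    ∫ r in (0 : ℝ)..1, slope h r * r = 1 := by
  have hd : ∀ r ∈ uIcc (0 : ℝ) 1,
      HasDerivAt (fun r => -Real.smoothTransition ((1 - r ^ 2) / h)) (slope h r * r) r := by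
    intro r _
    have h2 : HasDerivAt Real.smoothTransition
        (deriv Real.smoothTransition ((1 - r ^ 2) / h)) ((1 - r ^ 2) / h) :=
      ((Real.smoothTransition.contDiff (n := 1)).differentiable (by norm_num) _).hasDerivAt
    have h3 : HasDerivAt (fun r : ℝ => (1 - r ^ 2) / h) (-(2 * r) / h) r := by
      simpa using ((hasDerivAt_pow 2 r).const_sub 1).div_const h
    refine (h2.comp r h3).neg.congr_deriv ?_
    rw [slope]
    field_simp
  rw [intervalIntegral.integral_eq_sub_of_hasDerivAt hd]
  · have : (1 : ℝ) ≤ (1 - 0 ^ 2) / h := by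
      rw [le_div_iff₀ hh]; linarith
    rw [Real.smoothTransition.one_of_one_le this]
    simp
  · exact ((continuous_slope h).mul continuous_id).intervalIntegrable _ _

theorem toReal_sphereArea (hn : 2 ≤ n) : (sphereArea n).toReal
    = n * (volume : Measure (EuclideanSpace ℝ (Fin n))).real (Metric.ball 0 1) := by
  have : Nonempty (Fin n) := ⟨⟨0, by omega⟩⟩
  rw [sphereArea, Measure.toSphere_apply_univ, finrank_euclideanSpace_fin, ENNReal.toReal_mul,
    ENNReal.toReal_natCast]
  rfl

theorem sphereArea_ne_top (hn : 2 ≤ n) : sphereArea n ≠ ⊤ := by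
  have : Nonempty (Fin n) := ⟨⟨0, by omega⟩⟩
  rw [sphereArea, Measure.toSphere_apply_univ, finrank_euclideanSpace_fin]
  exact ENNReal.mul_ne_top (by simp) measure_ball_lt_top.ne

/-- In polar coordinates this is n|B_1| times a radial integral with weight r^{n-1} ≤ 1 on [0, 1],
and without the weight that integral is the total drop of the cutoff, namely 1. -/
theorem integral_slope_mul_norm_le (hn : 2 ≤ n) (hh : 0 < h) (h1 : h ≤ 1) :
    ∫ x : EuclideanSpace ℝ (Fin n), slope h ‖x‖ * ‖x‖ ≤ (sphereArea n).toReal := by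
  have : Nonempty (Fin n) := ⟨⟨0, by omega⟩⟩
  have h2 := integral_fun_norm_addHaar (volume : Measure (EuclideanSpace ℝ (Fin n)))
    (fun r => slope h r * r)
  rw [h2, toReal_sphereArea hn, finrank_euclideanSpace_fin, nsmul_eq_mul, smul_eq_mul, ← mul_assoc]
  refine mul_le_of_le_one_right (by positivity) ?_
  have hcont : Continuous fun r => r ^ (n - 1) • (slope h r * r) := by
    have := continuous_slope h
    fun_prop
  have hz : ∀ r ∈ Ioi (0 : ℝ) \ Ioc 0 1, r ^ (n - 1) • (slope h r * r) = 0 := by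
    intro r hr
    have : 1 < r := by
      by_contra hcon
      exact hr.2 ⟨hr.1, not_lt.1 hcon⟩
    simp [slope_eq_zero hh this]
  rw [setIntegral_eq_of_subset_of_forall_sdiff_eq_zero measurableSet_Ioi Ioc_subset_Ioi_self hz,
    ← intervalIntegral.integral_of_le zero_le_one]
  refine le_trans ?_ (integral_slope_mul_eq_one hh h1).le
  refine intervalIntegral.integral_mono_on zero_le_one (hcont.intervalIntegrable _ _)
    (((continuous_slope h).mul continuous_id).intervalIntegrable _ _) fun r hr => ?_
  exact mul_le_of_le_one_left (mul_nonneg (slope_nonneg hh r) hr.1) (pow_le_one₀ hr.1 hr.2)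

theorem integrable_slope_mul_norm (hh : 0 < h) :
    Integrable fun x : EuclideanSpace ℝ (Fin n) => slope h ‖x‖ * ‖x‖ := by
  have := continuous_slope h
  refine Continuous.integrable_of_hasCompactSupport (by fun_prop)
    (HasCompactSupport.intro (isCompact_closedBall (0 : EuclideanSpace ℝ (Fin n)) 1) fun x hx => ?_)
  rw [mem_closedBall_zero_iff, not_le] at hx
  simp [slope_eq_zero hh hx]

/-- The reflection of the `i`-th coordinate. -/
noncomputable def coordReflection (i : Fin n) :
    EuclideanSpace ℝ (Fin n) ≃ₗᵢ[ℝ] EuclideanSpace ℝ (Fin n) :=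
  LinearIsometryEquiv.piLpCongrRight 2 fun k =>
    if k = i then LinearIsometryEquiv.neg ℝ else LinearIsometryEquiv.refl ℝ ℝ

theorem coordReflection_apply_self (i : Fin n) (x : EuclideanSpace ℝ (Fin n)) :
    coordReflection i x i = -x i := by
  simp [coordReflection]

theorem coordReflection_apply_of_ne {i j : Fin n} (hij : j ≠ i) (x : EuclideanSpace ℝ (Fin n)) :
    coordReflection i x j = x j := by
  simp [coordReflection, hij]

theorem integral_radial_mul_coord_mul_coord_eq_zero (g : ℝ → ℝ) {i j : Fin n} (hij : i ≠ j) :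
    ∫ x : EuclideanSpace ℝ (Fin n), g ‖x‖ * (x i * x j) = 0 := by
  have h1 := (coordReflection i).measurePreserving.integral_comp
    (coordReflection i).toHomeomorph.measurableEmbedding
    (fun x : EuclideanSpace ℝ (Fin n) => g ‖x‖ * (x i * x j))
  simp only [LinearIsometryEquiv.norm_map, coordReflection_apply_self,
    coordReflection_apply_of_ne hij.symm] at h1
  simp only [neg_mul, mul_neg, integral_neg] at h1
  linarith

theorem integrable_slope_mul_coord_mul_coord (hh : 0 < h) (i j : Fin n) :
    Integrable fun x : EuclideanSpace ℝ (Fin n) => slope h ‖x‖ * ‖x‖⁻¹ * (x i * x j) := by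
  have hs := (continuous_slope h).measurable
  have hi : ∀ i : Fin n, Measurable fun x : EuclideanSpace ℝ (Fin n) => x i := fun i => by fun_prop
  have hi1 := hi i
  have hj1 := hi j
  refine (integrable_slope_mul_norm hh).mono' (by fun_prop) (Eventually.of_forall fun x => ?_)
  rw [norm_mul, norm_mul, norm_mul, norm_inv, norm_norm, Real.norm_of_nonneg (slope_nonneg hh _)]
  have h1 : ‖x i‖ * ‖x j‖ ≤ ‖x‖ * ‖x‖ :=
    mul_le_mul (PiLp.norm_apply_le x i) (PiLp.norm_apply_le x j) (norm_nonneg _) (norm_nonneg _)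
  calc slope h ‖x‖ * ‖x‖⁻¹ * (‖x i‖ * ‖x j‖) ≤ slope h ‖x‖ * ‖x‖⁻¹ * (‖x‖ * ‖x‖) := by
        have := slope_nonneg hh ‖x‖
        gcongr
    _ = slope h ‖x‖ * (‖x‖⁻¹ * ‖x‖ * ‖x‖) := by ring
    _ ≤ slope h ‖x‖ * ‖x‖ := by
        have := slope_nonneg hh ‖x‖
        gcongr
        exact mul_le_of_le_one_left (norm_nonneg _) inv_mul_le_one

/-- Reflecting one coordinate kills the off-diagonal terms, and the squares of the signs are 1. Thus
(σ·x)² has the same integral as |x|² against a radial weight, although σ has length √n. -/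
theorem integral_slope_mul_signed_sq (hh : 0 < h) {σ : Fin n → ℝ} (hσ : ∀ i, σ i * σ i = 1) :
    ∫ x : EuclideanSpace ℝ (Fin n), slope h ‖x‖ * ‖x‖⁻¹ * (∑ i, σ i * x i) ^ 2
      = ∫ x : EuclideanSpace ℝ (Fin n), slope h ‖x‖ * ‖x‖ := by
  have hI := fun i j => integrable_slope_mul_coord_mul_coord (n := n) hh i j
  have h1 : ∀ x : EuclideanSpace ℝ (Fin n), slope h ‖x‖ * ‖x‖⁻¹ * (∑ i, σ i * x i) ^ 2
      = ∑ i, ∑ j, σ i * σ j * (slope h ‖x‖ * ‖x‖⁻¹ * (x i * x j)) := by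
    intro x
    rw [sq, Finset.sum_mul_sum, Finset.mul_sum]
    refine Finset.sum_congr rfl fun i _ => ?_
    rw [Finset.mul_sum]
    exact Finset.sum_congr rfl fun j _ => by ring
  have h2 : ∀ x : EuclideanSpace ℝ (Fin n), slope h ‖x‖ * ‖x‖
      = ∑ i, slope h ‖x‖ * ‖x‖⁻¹ * (x i * x i) := by
    intro x
    have h3 : ∑ i, x i * x i = ‖x‖ ^ 2 := by
      rw [EuclideanSpace.real_norm_sq_eq]
      exact Finset.sum_congr rfl fun i _ => (sq (x i)).symm
    rw [← Finset.mul_sum, h3]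
    rcases eq_or_ne x 0 with rfl | hx
    · simp
    · have := norm_ne_zero_iff.2 hx
      field_simp
  simp_rw [h1, h2]
  rw [integral_finsetSum _ fun i _ => integrable_finsetSum _ fun j _ => (hI i j).const_mul _,
    integral_finsetSum _ fun i _ => hI i i]
  refine Finset.sum_congr rfl fun i _ => ?_
  rw [integral_finsetSum _ fun j _ => (hI i j).const_mul _, Finset.sum_eq_single i]
  · rw [integral_const_mul, hσ, one_mul]
  · intro j _ hj
    rw [integral_const_mul,
      integral_radial_mul_coord_mul_coord_eq_zero (fun r => slope h r * r⁻¹) hj.symm, mul_zero]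
  · simp

theorem integrable_slope_mul_signed_sq (hh : 0 < h) (σ : Fin n → ℝ) :
    Integrable fun x : EuclideanSpace ℝ (Fin n) =>
      slope h ‖x‖ * ‖x‖⁻¹ * (∑ i, σ i * x i) ^ 2 := by
  have h1 : (fun x : EuclideanSpace ℝ (Fin n) => slope h ‖x‖ * ‖x‖⁻¹ * (∑ i, σ i * x i) ^ 2)
      = fun x => ∑ i, ∑ j, σ i * σ j * (slope h ‖x‖ * ‖x‖⁻¹ * (x i * x j)) := by
    ext x
    rw [sq, Finset.sum_mul_sum, Finset.mul_sum]
    refine Finset.sum_congr rfl fun i _ => ?_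
    rw [Finset.mul_sum]
    exact Finset.sum_congr rfl fun j _ => by ring
  rw [h1]
  exact integrable_finsetSum _ fun i _ => integrable_finsetSum _ fun j _ =>
    (integrable_slope_mul_coord_mul_coord hh i j).const_mul _

/-- The flux of the gradient of the cutoff through any set is at most the area of the sphere,
even when measured in the `ℓ¹` norm. -/
theorem sum_abs_integral_fderiv_le (hn : 2 ≤ n) (hh : 0 < h) (h1 : h ≤ 1)
    {u : EuclideanSpace ℝ (Fin n) → ℝ} (hu : Measurable u) (hu1 : ∀ x, |u x| ≤ 1) :
    ∑ i, |∫ x, fderiv ℝ (radialCutoff n h) x (EuclideanSpace.single i 1) * u x|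
      ≤ (sphereArea n).toReal := by
  set c : Fin n → ℝ := fun i =>
    ∫ x, fderiv ℝ (radialCutoff n h) x (EuclideanSpace.single i 1) * u x with hc
  -- The gradient of the cutoff points inward, so signs opposite to those of the integrals make the
  -- sum an integral of slope · (σ·x) u.
  set σ : Fin n → ℝ := fun i => if 0 ≤ c i then -1 else 1 with hσ
  have hσ1 : ∀ i, σ i * σ i = 1 := fun i => by
    simp only [hσ]; split_ifs <;> norm_num
  have hσc : ∀ i, |c i| = -(σ i * c i) := fun i => by
    simp only [hσ]
    split_ifs with h0
    · rw [abs_of_nonneg h0]; ring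
    · rw [abs_of_neg (not_le.1 h0)]; ring
  have hs := (continuous_slope h).measurable
  have hint : ∀ i : Fin n, Integrable fun x : EuclideanSpace ℝ (Fin n) =>
      slope h ‖x‖ * x i * u x := by
    intro i
    have hi : Measurable fun x : EuclideanSpace ℝ (Fin n) => x i := by fun_prop
    refine (integrable_slope_mul_norm hh).mono' (by fun_prop) (Eventually.of_forall fun x => ?_)
    rw [norm_mul, norm_mul, Real.norm_of_nonneg (slope_nonneg hh _), Real.norm_eq_abs (u x)]
    have h2 := PiLp.norm_apply_le x i
    have h3 := slope_nonneg hh ‖x‖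
    calc slope h ‖x‖ * ‖x i‖ * |u x| ≤ slope h ‖x‖ * ‖x‖ * 1 := by
          have := hu1 x
          gcongr
      _ = _ := mul_one _
  have hci : ∀ i, c i = -∫ x : EuclideanSpace ℝ (Fin n), slope h ‖x‖ * x i * u x := by
    intro i
    simp only [hc, fderiv_apply_single, neg_mul, integral_neg]
  calc ∑ i, |c i| = ∑ i, ∫ x : EuclideanSpace ℝ (Fin n), σ i * (slope h ‖x‖ * x i * u x) := by
        refine Finset.sum_congr rfl fun i _ => ?_
        rw [hσc, hci, integral_const_mul]
        ring
    _ = ∫ x : EuclideanSpace ℝ (Fin n), ∑ i, σ i * (slope h ‖x‖ * x i * u x) :=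
        (integral_finsetSum _ fun i _ => (hint i).const_mul _).symm
    _ ≤ ∫ x : EuclideanSpace ℝ (Fin n),
          (slope h ‖x‖ * ‖x‖⁻¹ * (∑ i, σ i * x i) ^ 2 + slope h ‖x‖ * ‖x‖) / 2 := by
        refine integral_mono (integrable_finsetSum _ fun i _ => (hint i).const_mul _)
          (((integrable_slope_mul_signed_sq hh σ).add (integrable_slope_mul_norm hh)).div_const 2)
          fun x => ?_
        simp only
        have h2 : ∑ i, σ i * (slope h ‖x‖ * x i * u x)
            = slope h ‖x‖ * ((∑ i, σ i * x i) * u x) := by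
          rw [Finset.sum_mul, Finset.mul_sum]
          exact Finset.sum_congr rfl fun i _ => by ring
        set S := ∑ i, σ i * x i with hS
        have h3 : S * u x ≤ |S| := by
          refine (le_abs_self _).trans ?_
          rw [abs_mul]
          exact mul_le_of_le_one_right (abs_nonneg _) (hu1 x)
        -- The arithmetic-geometric mean inequality; after integration both halves agree, so no
        -- factor √n is lost.
        have h4 : |S| ≤ (‖x‖⁻¹ * S ^ 2 + ‖x‖) / 2 := by
          rcases eq_or_ne x 0 with rfl | hx
          · simp [hS]
          · have hx' := norm_pos_iff.2 hx
            rw [← sub_nonneg]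
            have : (‖x‖⁻¹ * S ^ 2 + ‖x‖) / 2 - |S| = ‖x‖⁻¹ * (|S| - ‖x‖) ^ 2 / 2 := by
              rw [← sq_abs S]
              field_simp
              ring
            rw [this]
            positivity
        rw [h2]
        have h5 := mul_le_mul_of_nonneg_left (h3.trans h4) (slope_nonneg hh ‖x‖)
        refine h5.trans (le_of_eq ?_)
        ring
    _ = ∫ x : EuclideanSpace ℝ (Fin n), slope h ‖x‖ * ‖x‖ := by
        rw [integral_div, integral_add (integrable_slope_mul_signed_sq hh σ)
          (integrable_slope_mul_norm hh), integral_slope_mul_signed_sq hh hσ1]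
        ring
    _ ≤ _ := integral_slope_mul_norm_le hn hh h1

end radialCutoff

/-! ### From gained and lost volumes to the total variation. -/

/-- The characteristic function of the part of `E` inside the ball of radius two. -/
noncomputable def localChar (E : Set (EuclideanSpace ℝ (Fin n))) :
    EuclideanSpace ℝ (Fin n) → ℝ :=
  (E ∩ Metric.ball 0 2).indicator fun _ => 1

theorem measurable_localChar {E : Set (EuclideanSpace ℝ (Fin n))} (hE : MeasurableSet E) :
    Measurable (localChar E) :=
  measurable_const.indicator (hE.inter measurableSet_ball)

theorem abs_localChar_le (E : Set (EuclideanSpace ℝ (Fin n))) (x : EuclideanSpace ℝ (Fin n)) :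
    |localChar E x| ≤ 1 := by
  unfold localChar
  by_cases h : x ∈ E ∩ Metric.ball 0 2 <;> simp [h]

theorem integrable_localChar {E : Set (EuclideanSpace ℝ (Fin n))} (hE : MeasurableSet E) :
    Integrable (localChar E) := by
  refine (integrable_indicator_iff (hE.inter measurableSet_ball)).2 ?_
  exact integrableOn_const ((measure_mono inter_subset_right).trans_lt measure_ball_lt_top).ne

/-- Moving the translation onto the characteristic function leaves values 1 on the gained set and -1
on the lost one. Truncating E to B_2 is harmless because f lives in B_1 and |a| ≤ 1. -/
theorem integral_translate_sub_mul_localChar {E : Set (EuclideanSpace ℝ (Fin n))}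
    (hE : MeasurableSet E) {f : EuclideanSpace ℝ (Fin n) → ℝ} (hf : Continuous f)
    (hf0 : ∀ x, x ∉ Metric.ball (0 : EuclideanSpace ℝ (Fin n)) 1 → f x = 0)
    {a : EuclideanSpace ℝ (Fin n)} (ha : ‖a‖ ≤ 1) :
    ∫ x, (f (x + a) - f x) * localChar E x
      = (∫ x in gained E a, f x) - ∫ x in lost E a, f x := by
  have hfc : HasCompactSupport f :=
    HasCompactSupport.intro (isCompact_closedBall (0 : EuclideanSpace ℝ (Fin n)) 1) fun x hx =>
      hf0 x fun h => hx (Metric.ball_subset_closedBall h)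
  have hfi : Integrable f := hf.integrable_of_hasCompactSupport hfc
  have hu := measurable_localChar hE
  have hbd : ∀ b : EuclideanSpace ℝ (Fin n),
      Integrable fun x => f x * localChar E (x - b) := fun b =>
    hfi.mul_bdd (c := 1) (hu.comp (measurable_id.sub_const b)).aestronglyMeasurable
      (Eventually.of_forall fun x => abs_localChar_le E _)
  have hbd0 : Integrable fun x => f x * localChar E x := by simpa using hbd 0
  have hbda : Integrable fun x => f (x + a) * localChar E x := by
    simpa using (hbd a).comp_add_right a
  have h1 : ∫ x, f (x + a) * localChar E x = ∫ x, f x * localChar E (x - a) := by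
    rw [← integral_sub_right_eq_self _ a]
    simp
  have hgm := measurableSet_gained hE a
  have hlm := measurableSet_lost hE a
  rw [← integral_indicator hgm, ← integral_indicator hlm,
    ← integral_sub (hfi.indicator hgm) (hfi.indicator hlm)]
  simp_rw [sub_mul]
  rw [integral_sub hbda hbd0, h1, ← integral_sub (hbd a) hbd0]
  congr 1
  ext x
  by_cases hx : x ∈ Metric.ball (0 : EuclideanSpace ℝ (Fin n)) 1
  · have hx1 := mem_ball_zero_iff.1 hx
    have hx2 : x ∈ Metric.ball (0 : EuclideanSpace ℝ (Fin n)) 2 := by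
      rw [mem_ball_zero_iff]; linarith
    have hxa : x - a ∈ Metric.ball (0 : EuclideanSpace ℝ (Fin n)) 2 := by
      rw [mem_ball_zero_iff]
      linarith [norm_sub_le x a]
    by_cases h2 : x ∈ E <;> by_cases h3 : x - a ∈ E <;>
      simp only [localChar, indicator, mem_inter_iff, gained, lost, mem_ofPred_eq, hx, hx2, hxa,
        h2, h3] <;> simp
  · have h2 : x ∉ gained E a := fun h => hx h.1
    have h3 : x ∉ lost E a := fun h => hx h.1
    simp [hf0 x hx, h2, h3]

/-- With p and q the integrals of χ over the gained and lost sets, the left side is at most p + q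
while the integral of the translated difference of χ is p - q. The identity (p + q)² = (p - q)² +
4pq then gives the bound. -/
theorem integral_translate_sub_le {E : Set (EuclideanSpace ℝ (Fin n))}
    (hE : MeasurableSet E) {f χ : EuclideanSpace ℝ (Fin n) → ℝ} (hf : Continuous f)
    (hχ : Continuous χ) (hfχ : ∀ x, |f x| ≤ χ x) (hχ1 : ∀ x, χ x ≤ 1)
    (hχ0 : ∀ x, x ∉ Metric.ball (0 : EuclideanSpace ℝ (Fin n)) 1 → χ x = 0)
    {a : EuclideanSpace ℝ (Fin n)} (ha : ‖a‖ ≤ 1) :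
    ∫ x, (f (x + a) - f x) * localChar E x
      ≤ |∫ x, (χ (x + a) - χ x) * localChar E x|
        + Real.sqrt (4 * (volume.real (gained E a) * volume.real (lost E a))) := by
  have hf0 : ∀ x, x ∉ Metric.ball (0 : EuclideanSpace ℝ (Fin n)) 1 → f x = 0 := fun x hx => by
    have := hfχ x
    rw [hχ0 x hx] at this
    exact abs_nonpos_iff.1 this
  have hint : ∀ g : EuclideanSpace ℝ (Fin n) → ℝ, Continuous g →
      (∀ x, x ∉ Metric.ball (0 : EuclideanSpace ℝ (Fin n)) 1 → g x = 0) → Integrable g := by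
    intro g hg hg0
    exact hg.integrable_of_hasCompactSupport
      (HasCompactSupport.intro (isCompact_closedBall (0 : EuclideanSpace ℝ (Fin n)) 1) fun x hx =>
        hg0 x fun h => hx (Metric.ball_subset_closedBall h))
  have hfi := hint f hf hf0
  have hχi := hint χ hχ hχ0
  rw [integral_translate_sub_mul_localChar hE hf hf0 ha,
    integral_translate_sub_mul_localChar hE hχ hχ0 ha]
  have hfin : ∀ S : Set (EuclideanSpace ℝ (Fin n)), S ⊆ Metric.ball 0 1 → volume S ≠ ⊤ :=
    fun S hS => ((measure_mono hS).trans_lt measure_ball_lt_top).ne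
  have hup : ∀ S : Set (EuclideanSpace ℝ (Fin n)), S ⊆ Metric.ball 0 1 →
      ∫ x in S, χ x ≤ volume.real S := by
    intro S hS
    calc ∫ x in S, χ x ≤ ∫ x in S, (1 : ℝ) :=
          integral_mono hχi.integrableOn (integrableOn_const (hfin S hS)) hχ1
      _ = volume.real S := by simp
  have hnn : ∀ S : Set (EuclideanSpace ℝ (Fin n)), 0 ≤ ∫ x in S, χ x := fun S =>
    integral_nonneg fun x => (abs_nonneg _).trans (hfχ x)
  have h1 : ∫ x in gained E a, f x ≤ ∫ x in gained E a, χ x :=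
    integral_mono hfi.integrableOn hχi.integrableOn fun x => (le_abs_self _).trans (hfχ x)
  have h2 : -∫ x in lost E a, f x ≤ ∫ x in lost E a, χ x := by
    rw [← integral_neg]
    exact integral_mono hfi.integrableOn.neg hχi.integrableOn fun x =>
      (neg_le_abs _).trans (hfχ x)
  have hp := hup (gained E a) fun x hx => hx.1
  have hq := hup (lost E a) fun x hx => hx.1
  have hp0 := hnn (gained E a)
  have hq0 := hnn (lost E a)
  set p := ∫ x in gained E a, χ x
  set q := ∫ x in lost E a, χ x
  have hpq : p * q ≤ volume.real (gained E a) * volume.real (lost E a) :=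
    mul_le_mul hp hq hq0 measureReal_nonneg
  have hs : p + q ≤ |p - q|
      + Real.sqrt (4 * (volume.real (gained E a) * volume.real (lost E a))) := by
    refine le_of_sq_le_sq ?_ (by positivity)
    have h3 := Real.sq_sqrt (show 0 ≤ 4 * (volume.real (gained E a) * volume.real (lost E a)) by
      positivity)
    set s := Real.sqrt (4 * (volume.real (gained E a) * volume.real (lost E a)))
    have hs0 : 0 ≤ s := Real.sqrt_nonneg _
    have h4 := sq_abs (p - q)
    have h5 : 0 ≤ |p - q| * s := by positivity
    nlinarith
  linarith

/-- A one-dimensional estimate for the distributional derivative of a characteristic function,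
from the quadratic decay of the products of gained and lost volumes. -/
theorem integral_fderiv_mul_localChar_le {E : Set (EuclideanSpace ℝ (Fin n))}
    (hE : MeasurableSet E) {f χ : EuclideanSpace ℝ (Fin n) → ℝ} (hf : ContDiff ℝ 1 f)
    (hχ : ContDiff ℝ 1 χ) (hfc : HasCompactSupport f) (hχc : HasCompactSupport χ)
    (hfχ : ∀ x, |f x| ≤ χ x) (hχ1 : ∀ x, χ x ≤ 1)
    (hχ0 : ∀ x, x ∉ Metric.ball (0 : EuclideanSpace ℝ (Fin n)) 1 → χ x = 0)
    {v : EuclideanSpace ℝ (Fin n)} (hv : ‖v‖ = 1) {P : ENNReal} (hP : P ≠ ⊤)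
    (hgl : ∀ ε : ℝ, 0 < ε → ∃ t₀ : ℝ, 0 < t₀ ∧ ∀ t : ℝ, |t| < t₀ →
      2 * (volume (gained E (t • v)) * volume (lost E (t • v)))
        ≤ ENNReal.ofReal (t ^ 2) * P + ENNReal.ofReal (ε * t ^ 2)) :
    ∫ x, fderiv ℝ f x v * localChar E x
      ≤ |∫ x, fderiv ℝ χ x v * localChar E x| + Real.sqrt (2 * P.toReal) := by
  have hlim : ∀ g : EuclideanSpace ℝ (Fin n) → ℝ, ContDiff ℝ 1 g → HasCompactSupport g →
      Tendsto (fun t : ℝ => t⁻¹ * ∫ x, (g (x + t • v) - g x) * localChar E x) (𝓝[>] 0)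
        (𝓝 (∫ x, fderiv ℝ g x v * localChar E x)) := by
    intro g hg hgc
    obtain ⟨C, hC⟩ := hg.lipschitzWith_of_hasCompactSupport hgc (by norm_num)
    have h := hC.integral_inv_smul_sub_mul_tendsto_integral_lineDeriv_mul
      (integrable_localChar hE) v (μ := volume)
    have h1 : ∀ x, lineDeriv ℝ g x v = fderiv ℝ g x v := fun x =>
      (hg.differentiable (by norm_num) x).lineDeriv_eq_fderiv
    simp only [h1, smul_eq_mul, mul_assoc, integral_const_mul] at h
    exact h
  -- Dividing by t makes the root √(2P + 2ε), because the product of the volumes is at most (P +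
  -- ε)t²/2; only afterwards does ε tend to 0.
  have hε : ∀ ε : ℝ, 0 < ε → ∫ x, fderiv ℝ f x v * localChar E x
      ≤ |∫ x, fderiv ℝ χ x v * localChar E x| + Real.sqrt (2 * P.toReal + 2 * ε) := by
    intro ε hε
    obtain ⟨t₀, ht₀, hbd⟩ := hgl ε hε
    refine le_of_tendsto_of_tendsto (hlim f hf hfc)
      (((hlim χ hχ hχc).abs).add_const (Real.sqrt (2 * P.toReal + 2 * ε))) ?_
    filter_upwards [Ioo_mem_nhdsGT (show (0 : ℝ) < min t₀ 1 by positivity)] with t ht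
    have ht0 : 0 < t := ht.1
    have htt₀ : |t| < t₀ := by
      rw [abs_of_pos ht0]
      exact ht.2.trans_le (min_le_left _ _)
    have hta : ‖t • v‖ ≤ 1 := by
      rw [norm_smul, hv, mul_one, Real.norm_of_nonneg ht0.le]
      exact (ht.2.trans_le (min_le_right _ _)).le
    have h := integral_translate_sub_le hE hf.continuous hχ.continuous hfχ hχ1 hχ0 hta
    have hprod : 4 * (volume.real (gained E (t • v)) * volume.real (lost E (t • v)))
        ≤ (2 * P.toReal + 2 * ε) * t ^ 2 := by
      have h1 := ENNReal.toReal_mono (ENNReal.add_ne_top.2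
        ⟨ENNReal.mul_ne_top ENNReal.ofReal_ne_top hP, ENNReal.ofReal_ne_top⟩) (hbd t htt₀)
      rw [ENNReal.toReal_add (ENNReal.mul_ne_top ENNReal.ofReal_ne_top hP) ENNReal.ofReal_ne_top,
        ENNReal.toReal_mul, ENNReal.toReal_mul, ENNReal.toReal_mul,
        ENNReal.toReal_ofReal (by positivity), ENNReal.toReal_ofReal (by positivity)] at h1
      have h2 : (2 : ENNReal).toReal = 2 := by simp
      rw [h2] at h1
      simp only [Measure.real]
      linarith
    have hsqrt : Real.sqrt (4 * (volume.real (gained E (t • v)) * volume.real (lost E (t • v))))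
        ≤ Real.sqrt (2 * P.toReal + 2 * ε) * t := by
      refine (Real.sqrt_le_sqrt hprod).trans (le_of_eq ?_)
      rw [Real.sqrt_mul' _ (sq_nonneg t), Real.sqrt_sq ht0.le]
    rw [abs_mul, abs_of_pos (inv_pos.2 ht0)]
    have h3 := mul_le_mul_of_nonneg_left (h.trans (add_le_add_right hsqrt _))
      (inv_pos.2 ht0).le
    refine h3.trans (le_of_eq ?_)
    field_simp
  have hcont : Tendsto (fun ε : ℝ => |∫ x, fderiv ℝ χ x v * localChar E x|
      + Real.sqrt (2 * P.toReal + 2 * ε)) (𝓝[>] 0)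
      (𝓝 (|∫ x, fderiv ℝ χ x v * localChar E x| + Real.sqrt (2 * P.toReal + 2 * 0))) :=
    (Continuous.tendsto (by fun_prop) 0).mono_left nhdsWithin_le_nhds
  rw [mul_zero, add_zero] at hcont
  exact ge_of_tendsto hcont (by filter_upwards [self_mem_nhdsWithin] with ε hε' using hε ε hε')

theorem exists_sq_norm_le_of_tsupport_subset {φ : EuclideanSpace ℝ (Fin n) →
    EuclideanSpace ℝ (Fin n)} (hφ : tsupport φ ⊆ Metric.ball 0 1) :
    ∃ h : ℝ, 0 < h ∧ h ≤ 1 ∧ ∀ x ∈ tsupport φ, ‖x‖ ^ 2 ≤ 1 - h := by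
  obtain ⟨r, hr, hsub⟩ := exists_lt_subset_ball (isClosed_tsupport φ) hφ
  refine ⟨1 - (max r 0) ^ 2, ?_, by linarith [sq_nonneg (max r 0)], fun x hx => ?_⟩
  · have h1 : max r 0 < 1 := max_lt hr one_pos
    have h0 : 0 ≤ max r 0 := le_max_right _ _
    nlinarith
  · have h1 := mem_ball_zero_iff.1 (hsub hx)
    have h2 : ‖x‖ ≤ max r 0 := h1.le.trans (le_max_left _ _)
    have := pow_le_pow_left₀ (norm_nonneg x) h2 2
    linarith

/-- The divergence is treated coordinate by coordinate, with the same radial cutoff dominating every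
component of φ. The n roots √(2P) and the ℓ¹ flux of that single cutoff give the two terms. -/
theorem setIntegral_charFn_mul_divergence_le {E₀ E : Set (EuclideanSpace ℝ (Fin n))}
    (hn : 2 ≤ n) (hE : MeasurableSet E) (hEE : E₀ =ᵐ[volume] E) {P : ENNReal} (hP : P ≠ ⊤)
    (hgl : ∀ v : EuclideanSpace ℝ (Fin n), ‖v‖ = 1 →
      ∀ ε : ℝ, 0 < ε → ∃ t₀ : ℝ, 0 < t₀ ∧ ∀ t : ℝ, |t| < t₀ →
      2 * (volume (gained E (t • v)) * volume (lost E (t • v)))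
        ≤ ENNReal.ofReal (t ^ 2) * P + ENNReal.ofReal (ε * t ^ 2))
    {φ : EuclideanSpace ℝ (Fin n) → EuclideanSpace ℝ (Fin n)} (hφ : ContDiff ℝ 1 φ)
    (hφc : HasCompactSupport φ) (hφB : tsupport φ ⊆ Metric.ball 0 1) (hφ1 : ∀ x, ‖φ x‖ ≤ 1) :
    ∫ x in Metric.ball 0 1, charFn E₀ x * divergence φ x
      ≤ Real.sqrt 2 * n * Real.sqrt P.toReal + (sphereArea n).toReal := by
  obtain ⟨h, hh, h1, hsupp⟩ := exists_sq_norm_le_of_tsupport_subset hφB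
  set f : Fin n → EuclideanSpace ℝ (Fin n) → ℝ := fun i x => φ x i with hf
  have hfsm : ∀ i, ContDiff ℝ 1 (f i) := fun i => contDiff_euclidean.1 hφ i
  have hfc : ∀ i, HasCompactSupport (f i) := fun i =>
    hφc.comp_left (g := fun y : EuclideanSpace ℝ (Fin n) => y i) rfl
  have hfd : ∀ i x w, fderiv ℝ (f i) x w = fderiv ℝ φ x w i := by
    intro i x w
    have h2 : HasFDerivAt (f i) _ x := (EuclideanSpace.proj (𝕜 := ℝ) i).hasFDerivAt.comp x
      (hφ.differentiable (by norm_num) x).hasFDerivAt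
    rw [h2.fderiv]
    rfl
  have hfχ : ∀ i x, |f i x| ≤ radialCutoff n h x := by
    intro i x
    by_cases hx : x ∈ tsupport φ
    · rw [radialCutoff.eq_one hh (hsupp x hx)]
      exact (PiLp.norm_apply_le (φ x) i).trans (hφ1 x)
    · have : f i x = 0 := by simp [hf, image_eq_zero_of_notMem_tsupport hx]
      rw [this, abs_zero]
      exact Real.smoothTransition.nonneg _
  have hu := measurable_localChar hE
  have hint : ∀ i, Integrable fun x =>
      fderiv ℝ (f i) x (EuclideanSpace.single i 1) * localChar E x := by
    intro i
    have hc : Continuous fun x => fderiv ℝ (f i) x (EuclideanSpace.single i 1) :=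
      ((hfsm i).continuous_fderiv (by norm_num)).clm_apply continuous_const
    have hcc : HasCompactSupport fun x => fderiv ℝ (f i) x (EuclideanSpace.single i 1) :=
      (hfc i).fderiv_apply ℝ _
    exact (hc.integrable_of_hasCompactSupport hcc).mul_bdd (c := 1) hu.aestronglyMeasurable
      (Eventually.of_forall fun x => abs_localChar_le E x)
  have hsum : ∫ x in Metric.ball 0 1, charFn E₀ x * divergence φ x
      = ∑ i, ∫ x, fderiv ℝ (f i) x (EuclideanSpace.single i 1) * localChar E x := by
    rw [← integral_finsetSum _ fun i _ => hint i, ← integral_indicator measurableSet_ball]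
    refine integral_congr_ae ?_
    filter_upwards [hEE.mem_iff] with x hx
    simp only [hfd, ← Finset.sum_mul]
    by_cases hxB : x ∈ Metric.ball (0 : EuclideanSpace ℝ (Fin n)) 1
    · rw [indicator_of_mem hxB, mul_comm]
      have hx2 : x ∈ Metric.ball (0 : EuclideanSpace ℝ (Fin n)) 2 :=
        Metric.ball_subset_ball (by norm_num) hxB
      have : charFn E₀ x = localChar E x := by
        unfold charFn localChar
        by_cases hxE : x ∈ E
        · rw [indicator_of_mem (hx.2 hxE), indicator_of_mem (mem_inter hxE hx2)]
        · rw [indicator_of_notMem fun h => hxE (hx.1 h), indicator_of_notMem fun h => hxE h.1]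
      rw [this]
      rfl
    · have h0 : fderiv ℝ φ x = 0 := by
        have h2 : x ∉ tsupport φ := fun h => hxB (hφB h)
        exact image_eq_zero_of_notMem_tsupport fun h3 => h2 (tsupport_fderiv_subset ℝ h3)
      rw [indicator_of_notMem hxB, h0]
      simp
  have hdir : ∀ i, ∫ x, fderiv ℝ (f i) x (EuclideanSpace.single i 1) * localChar E x
      ≤ |∫ x, fderiv ℝ (radialCutoff n h) x (EuclideanSpace.single i 1) * localChar E x|
        + Real.sqrt (2 * P.toReal) := by
    intro i
    have hv : ‖(EuclideanSpace.single i 1 : EuclideanSpace ℝ (Fin n))‖ = 1 := by simp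
    exact integral_fderiv_mul_localChar_le hE (hfsm i) (radialCutoff.contDiff n h) (hfc i)
      (radialCutoff.hasCompactSupport hh) (hfχ i) (fun x => Real.smoothTransition.le_one _)
      (fun x hx => radialCutoff.eq_zero hh hx) hv hP (hgl _ hv)
  rw [hsum]
  refine (Finset.sum_le_sum fun i _ => hdir i).trans ?_
  rw [Finset.sum_add_distrib, add_comm]
  refine add_le_add (le_of_eq ?_)
    (radialCutoff.sum_abs_integral_fderiv_le hn hh h1 hu (abs_localChar_le E))
  rw [Finset.sum_const, Finset.card_univ, Fintype.card_fin, nsmul_eq_mul,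
    Real.sqrt_mul (by norm_num)]
  ring

end

theorem theorem1p4 (n : ℕ) (hn : 2 ≤ n) (K Kstar : EuclideanSpace ℝ (Fin n) → ℝ)
    (hK : IsAdmissibleKernel K Kstar)
    (E : Set (EuclideanSpace ℝ (Fin n))) (hE : NullMeasurableSet E volume)
    (hstable : IsStableSet K (Metric.ball 0 4) E)
    (hfin : nonlocalPerimeter Kstar (Metric.ball 0 4) E < ⊤) :
    MemBV (charFn E) (Metric.ball 0 1) ∧
    classicalPerimeter (Metric.ball 0 1) E
      ≤ ENNReal.ofReal (Real.sqrt 2 * n *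
          Real.sqrt (nonlocalPerimeter Kstar (Metric.ball 0 4) E).toReal)
        + sphereArea n := by
  -- The estimates run on a measurable representative. Stability is assumed for E itself and
  -- transfers because the displacements map null sets to null sets.
  obtain ⟨E', hE'm, hE'⟩ : ∃ E', MeasurableSet E' ∧ E =ᵐ[volume] E' :=
    ⟨toMeasurable volume E, measurableSet_toMeasurable _ _, hE.toMeasurable_ae_eq.symm⟩
  have hPeq := nonlocalPerimeter_congr (K := Kstar) (Ω := Metric.ball 0 4) hE'
  have hbound : classicalPerimeter (Metric.ball 0 1) E
      ≤ ENNReal.ofReal (Real.sqrt 2 * n *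
          Real.sqrt (nonlocalPerimeter Kstar (Metric.ball 0 4) E).toReal)
        + sphereArea n := by
    refine iSup₂_le fun φ hφ => ?_
    obtain ⟨hφ, hφc, hφB, hφ1⟩ := hφ
    have h := setIntegral_charFn_mul_divergence_le hn hE'm hE' (hPeq ▸ hfin.ne)
      (fun v hv ε hε => volume_gained_mul_lost_le hK hn hstable hE'm hE' hv hε) hφ hφc hφB hφ1
    rw [← hPeq] at h
    refine (ENNReal.ofReal_le_ofReal h).trans ?_
    rw [ENNReal.ofReal_add (by positivity) ENNReal.toReal_nonneg,
      ENNReal.ofReal_toReal (radialCutoff.sphereArea_ne_top hn)]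
  refine ⟨⟨?_, hbound.trans_lt ?_⟩, hbound⟩
  · have h1 : IntegrableOn (fun _ : EuclideanSpace ℝ (Fin n) => (1 : ℝ)) (Metric.ball 0 1) :=
      integrableOn_const measure_ball_lt_top.ne
    exact h1.indicator₀ (hE.mono_ac Measure.restrict_le_self.absolutelyContinuous)
  · exact ENNReal.add_lt_top.2
      ⟨ENNReal.ofReal_lt_top, lt_top_iff_ne_top.2 (radialCutoff.sphereArea_ne_top hn)⟩
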